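/- **Setup.** Let $G$ be a finite connected multigraph without loops and with at least one edge, equipped with a ribbon structure, i.e. a cyclic ordering ("counterclockwise") of the edges around each vertex. Assume that $G$ has no bridge and that the ribbon structure is planar: gluing a disk to every boundary component of the thickened graph gives a sphere. *Divisors.* $\operatorname{Div}(G)=\mathbb Z^{V(G)}$; two divisors are equivalent if they differ by some $\Delta f$, $f:V(G)\to\mathbb Z$, where $(\Delta f)(v)=\sum_{e=vw}(f(v)-f(w))$; $\operatorname{Pic}^d(G)$ is the set of classes of degree-$d$ divisors, and $g(G)=\#E(G)-\#V(G)+1$. $S(G)$ is the set of spanning trees. *Bernardi action.* Let $v$ be a vertex, $e$ an edge at $v$, $T\in S(G)$. The tour of $T$ starts at $v$ considering $e$; when at $x$ considering an edge $f$ it either, if $f=xy\in T$, walks to $y$ and considers the edge after $f$ around $y$, or, if $f\notin T$, cuts through $f$ and considers the edge after $f$ around $x$. Let $\beta_{(v,e)}(T)$ be the sum over all edges $f\notin T$ of the vertex from which $f$ is first cut through. When $T\mapsto[\beta_{(v,e)}(T)]$ is a bijection $S(G)\to\operatorname{Pic}^{g(G)}(G)$, it transports the translation action of $\operatorname{Pic}^0(G)$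 to an action $(\gamma,T)\mapsto\beta(\gamma,T)$ on $S(G)$: $\beta(\gamma,T)$ is the tree $T'$ with $[\beta_{(v,e)}(T')]=\gamma+[\beta_{(v,e)}(T)]$. *Duality.* The dual ribbon graph $G^\star$ has the faces of $G$ as vertices and one edge $e^\star$ for each edge $e$ of $G$, joining the two faces along $e$; the cyclic orderings around its vertices use the opposite (clockwise) orientation. An oriented edge $\vec e$ of $G$ is identified with the oriented edge $\vec e^{\,\star}$ of $G^\star$ crossing $\vec e$ from its left to its right; this gives an isomorphism $c\mapsto c^\star$ from the integral 1-chains $C$ of $G$ to the integral 1-chains $C^\star$ of $G^\star$. Let $\partial$ be the boundary map (head minus tail), $Z=\ker\partial$ the lattice of integer flows, $B=\{\vec e\mapsto f(\mathrm{head}\,\vec e)-f(\mathrm{tail}\,\vec e)\ :\ f:V(G)\to\mathbb Z\}$ the lattice of integer cuts, and $Z^\star,B^\star$ those of $G^\star$. **Theorem.** 1. For all initial data the map $T\mapsto[\beta_{(v,e)}(T)]$ is a bijection $S(G)\to\operatorname{Pic}^{g(G)}(G)$, and likewise for $G^\star$. 2. $\sigma(T)=\{e^\star : e\notin T\}$ defines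 a bijection $\sigma:S(G)\to S(G^\star)$. 3. The maps $C/(Z+B)\to\operatorname{Pic}^0(G)$ and $C^\star/(Z^\star+B^\star)\to\operatorname{Pic}^0(G^\star)$ induced by $\partial$, and the map $C/(Z+B)\to C^\star/(Z^\star+B^\star)$ induced by $c\mapsto c^\star$, are well-defined isomorphisms; let $\Psi:\operatorname{Pic}^0(G)\to\operatorname{Pic}^0(G^\star)$ be the resulting isomorphism. 4. For every choice of the initial data defining the Bernardi actions $\beta$ on $S(G)$ and $\beta^\star$ on $S(G^\star)$, $$\beta^\star(\Psi(\gamma),\sigma(T))=\sigma(\beta(\gamma,T))\qquad\text{for all }\gamma\in\operatorname{Pic}^0(G),\ T\in S(G).$$ -/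

import Mathlib

/-- A finite multigraph with vertex set `V` together with a cyclic ordering of the edge-ends around
each vertex.  `D` is the set of oriented edges (darts): `tail d` is the initial vertex of `d`,
`rev d` is `d` with the opposite orientation (so an unoriented edge is a pair `{d, rev d}`), and
`next d` is the dart following `d` in the cyclic ordering of the darts that leave `tail d`.
The last axiom says that the darts leaving a vertex form exactly one cycle of `next`.
Connectedness and absence of loops are separate predicates below. -/
structure RibbonGraph (V : Type*) (D : Type*) where
  tail : D → V
  rev : D → D
  rev_rev : ∀ d, rev (rev d) = d
  rev_ne : ∀ d, rev d ≠ d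
  next : Equiv.Perm D
  sameCycle_iff : ∀ d d', next.SameCycle d d' ↔ tail d = tail d'

namespace RibbonGraph

section Graph

variable {V D : Type*} (G : RibbonGraph V D)

/-- Terminal vertex of an oriented edge. -/
def head (d : D) : V := G.tail (G.rev d)

def Loopless : Prop := ∀ d, G.tail d ≠ G.head d

/-- `u` and `v` are joined by a path using only edges from `A`. -/
def Reachable (A : Set D) (u v : V) : Prop :=
  Relation.ReflTransGen (fun x y => ∃ d ∈ A, G.tail d = x ∧ G.head d = y) u v

/-- The spanning subgraph with edge set `A` is connected. -/
def ConnectedOn (A : Set D) : Prop := Nonempty V ∧ ∀ u v, G.Reachable A u v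

def Connected : Prop := G.ConnectedOn Set.univ

/-- No edge is a bridge: deleting a single edge never disconnects the graph. -/
def Bridgeless : Prop := ∀ d, G.ConnectedOn ({d, G.rev d}ᶜ)

/-- A set of darts closed under reversal (that is, a set of unoriented edges) is a spanning tree if
the spanning subgraph it defines is connected and has no cycle; the latter is expressed by saying
that no edge of the subgraph has its endpoints joined by a path avoiding that edge. -/
structure IsSpanningTree (T : Set D) : Prop where
  rev_mem : ∀ d ∈ T, G.rev d ∈ T
  connected : G.ConnectedOn T
  acyclic : ∀ d ∈ T, ¬ G.Reachable (T \ {d, G.rev d}) (G.tail d) (G.head d)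

/-- The set `S(G)` of spanning trees. -/
def SpanningTree : Type _ := {T : Set D // G.IsSpanningTree T}

/-! The dual ribbon graph -/

/-- The orientation reversal as a permutation of the darts. -/
def revPerm : Equiv.Perm D := ⟨G.rev, G.rev, G.rev_rev, G.rev_rev⟩

/-- If `next` is counterclockwise rotation, then walking along the boundary of the face to the left
of `d`, keeping the face on the left, the dart traversed just before `d` is `rev (next d)`.
So this permutation goes *clockwise* around that face. -/
def dualNext : Equiv.Perm D := G.next.trans G.revPerm

/-- The faces, that is the boundary components of the thickened graph: `d` and `d'` have
the same left face iff they lie in the same cycle of `dualNext`. -/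
def Face : Type _ := Quotient (Equiv.Perm.SameCycle.setoid G.dualNext)

/-- The face to the left of a dart. -/
def leftFace (d : D) : G.Face := Quotient.mk _ d

/-- The dual ribbon graph.  Its vertices are the faces of `G`, and the dart `d` of `G` names the
dual dart crossing `d` from its left face to its right face (which is the left face of `rev d`).
The cyclic ordering around each face uses the opposite orientation of the surface. -/
def dual : RibbonGraph G.Face D where
  tail := G.leftFace
  rev := G.rev
  rev_rev := G.rev_rev
  rev_ne := G.rev_ne
  next := G.dualNext
  sameCycle_iff _ _ := Iff.symm (Quotient.eq (r := Equiv.Perm.SameCycle.setoid G.dualNext))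

noncomputable instance [Finite D] : Fintype G.Face :=
  @Fintype.ofFinite _ (inferInstanceAs (Finite (Quotient _)))

/-- The Euler characteristic of the closed surface obtained by gluing a disk to each
boundary component of the thickened graph (the number of edges is half the number of darts). -/
noncomputable def eulerChar : ℤ :=
  (Nat.card V : ℤ) - ((Nat.card D / 2 : ℕ) : ℤ) + (Nat.card G.Face : ℤ)

/-- The surface is the sphere (used for connected graphs with at least one edge). -/
def Planar : Prop := G.eulerChar = 2

end Graph

section Divisors

variable {V D : Type*} [Fintype D] (G : RibbonGraph V D)

open Classical in
/-- The Laplacian, as a homomorphism from integer functions to divisors; divisors are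
integer functions `V → ℤ` (coefficients). -/
noncomputable def laplacian : (V → ℤ) →+ (V → ℤ) :=
  AddMonoidHom.mk'
    (fun f v => ∑ d ∈ Finset.univ.filter (fun d => G.tail d = v), (f v - f (G.head d)))
    (by
      intro f g
      funext v
      simp only [Pi.add_apply, ← Finset.sum_add_distrib]
      exact Finset.sum_congr rfl fun d _ => by ring)

/-- Principal divisors. -/
noncomputable def prin : AddSubgroup (V → ℤ) := G.laplacian.range

/-- Divisors modulo linear equivalence. -/
abbrev Pic : Type _ := (V → ℤ) ⧸ G.prin

/-- The linear equivalence class of a divisor. -/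
noncomputable def divClass : (V → ℤ) →+ G.Pic := QuotientAddGroup.mk' G.prin

/-! Chains, flows and cuts -/

/-- Integral 1-chains: `c d` is the coefficient of the oriented edge `d`, and `rev d = -d`. -/
def chains : AddSubgroup (D → ℤ) where
  carrier := {c | ∀ d, c (G.rev d) = - c d}
  zero_mem' := fun d => by simp
  add_mem' := fun {a b} ha hb d => by
    have h1 := ha d
    have h2 := hb d
    simp only [Pi.add_apply, h1, h2]
    ring
  neg_mem' := fun {a} ha d => by
    have h1 := ha d
    simp only [Pi.neg_apply, h1]

open Classical in
/-- The boundary map, sending an oriented edge `d` to `(head d) - (tail d)`.  (In the sum at `v`,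
the edge `{d, rev d}` contributes `c d` at `head d` and `c (rev d) = - c d` at `tail d`.) -/
noncomputable def boundary : G.chains →+ (V → ℤ) :=
  AddMonoidHom.mk'
    (fun c v => ∑ d ∈ Finset.univ.filter (fun d => G.head d = v), c.1 d)
    (by
      intro f g
      funext v
      simp only [Pi.add_apply, ← Finset.sum_add_distrib]
      rfl)

/-- The coboundary of an integer function on the vertices. -/
def coboundary : (V → ℤ) →+ G.chains :=
  AddMonoidHom.mk'
    (fun f => ⟨fun d => f (G.head d) - f (G.tail d), fun d => by
      simp only [head, G.rev_rev]
      ring⟩)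
    (by
      intro f g
      apply Subtype.ext
      funext d
      show (f + g) _ - (f + g) _ = (f _ - f _) + (g _ - g _)
      simp only [Pi.add_apply]
      ring)

/-- The lattice of integer flows. -/
noncomputable def flows : AddSubgroup G.chains := G.boundary.ker

/-- The lattice of integer cuts. -/
def cuts : AddSubgroup G.chains := G.coboundary.range

/-- Chains modulo the lattice spanned by the flows and the cuts. -/
abbrev ChainQuot : Type _ := G.chains ⧸ (G.flows ⊔ G.cuts)

/-- The identification of the 1-chains of `G` with those of its dual, sending each oriented edge to
the dual oriented edge of the same name. -/
def dualChain (c : G.chains) : G.dual.chains := ⟨c.1, c.2⟩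

end Divisors

section Degree

variable {V D : Type*} [Fintype V] [Fintype D] (G : RibbonGraph V D)

/-- The group of divisors of degree zero. -/
def div0 : AddSubgroup (V → ℤ) where
  carrier := {x | ∑ v, x v = 0}
  zero_mem' := by simp
  add_mem' := fun {a b} ha hb => by
    have h1 : ∑ v, a v = 0 := ha
    have h2 : ∑ v, b v = 0 := hb
    show ∑ v, (a v + b v) = 0
    rw [Finset.sum_add_distrib, h1, h2, add_zero]
  neg_mem' := fun {a} ha => by
    have h1 : ∑ v, a v = 0 := ha
    show ∑ v, - a v = 0
    rw [Finset.sum_neg_distrib, h1, neg_zero]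

/-- The group of divisor classes of degree zero. -/
noncomputable def pic0 : AddSubgroup G.Pic := (div0 (V := V)).map G.divClass

/-- The set of divisor classes of degree `k`. -/
def picDeg (k : ℤ) : Set G.Pic := G.divClass '' {x | ∑ v, x v = k}

/-- The combinatorial genus `#E - #V + 1`. -/
@[nolint unusedArguments]
def genus (_G : RibbonGraph V D) : ℤ :=
  ((Fintype.card D / 2 : ℕ) : ℤ) - (Fintype.card V : ℤ) + 1

/-- `Ψ` is the canonical map `Pic⁰(G) ≅ C / (Z ⊕ B) ≅ C* / (Z* ⊕ B*) ≅ Pic⁰(G*)`, where the outer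
isomorphisms are (inverse to, resp. equal to) those induced by the boundary maps and the middle one
is induced by the identification of chains. -/
def IsDualityIso (Ψ : G.pic0 ≃+ G.dual.pic0) : Prop :=
  ∃ (a : G.ChainQuot ≃+ G.pic0) (θ : G.ChainQuot ≃+ G.dual.ChainQuot)
    (b : G.dual.ChainQuot ≃+ G.dual.pic0),
    (∀ c : G.chains,
      (a (QuotientAddGroup.mk c) : G.Pic) = G.divClass (G.boundary c)) ∧
    (∀ c : G.chains,
      θ (QuotientAddGroup.mk c) = QuotientAddGroup.mk (G.dualChain c)) ∧
    (∀ c : G.dual.chains,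
      (b (QuotientAddGroup.mk c) : G.dual.Pic) = G.dual.divClass (G.dual.boundary c)) ∧
    Ψ = (a.symm.trans θ).trans b

end Degree

section Bernardi

variable {V D : Type*} (G : RibbonGraph V D)

open Classical in
/-- One step of the tour around `T`: standing at `tail d` and considering the dart `d`,
either walk along `d` (if it is in `T`) and consider the next dart after its reversal at
the other endpoint, or cut through `d` and consider the next dart at the same vertex. -/
noncomputable def tourStep (T : Set D) (d : D) : D :=
  if d ∈ T then G.next (G.rev d) else G.next d

/-- The edge of `d` is first met by the tour starting at `d₀` in the orientation `d`,
that is, from the vertex `tail d`. -/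
def MetFirst (d₀ : D) (T : Set D) (d : D) : Prop :=
  ∃ n : ℕ, (G.tourStep T)^[n] d₀ = d ∧ ∀ m < n, (G.tourStep T)^[m] d₀ ≠ G.rev d

/-- The divisor `β_{(v,e)}(T)`, where the initial data `(v, e)` are encoded by the dart `d₀`, namely
`e` oriented away from `v`: each edge not in `T` drops one chip at the vertex from which the tour
first cuts through it. -/
noncomputable def bernardiDivisor (d₀ : D) (T : Set D) : V → ℤ :=
  fun v => (({d | d ∉ T ∧ G.MetFirst d₀ T d ∧ G.tail d = v} : Set D).ncard : ℤ)

/-- The class of the Bernardi divisor of a spanning tree. -/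
noncomputable def bernardiClass [Fintype D] (d₀ : D) (T : G.SpanningTree) : G.Pic :=
  G.divClass (G.bernardiDivisor d₀ T.1)

/-- The Bernardi action `γ · T = β⁻¹(γ + β(T))`, with `β` the Bernardi map from spanning trees
to divisor classes with initial data `d₀`. -/
noncomputable def bernardiAction [Fintype V] [Fintype D] (d₀ : D) (γ : G.pic0)
    (T : G.SpanningTree) : G.SpanningTree :=
  haveI : Nonempty G.SpanningTree := ⟨T⟩
  Function.invFun (G.bernardiClass d₀) ((γ : G.Pic) + G.bernardiClass d₀ T)

end Bernardi

end RibbonGraph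

/-! Encode a spanning tree T and a start d₀ by an orientation O(T, d₀) (`tourOrientation`): tree
edges point the way they are first walked, the other edges point to the vertex from which they are
first cut. Positively oriented tree edges enter every vertex except the root exactly once, so the
indegree function of O is the Bernardi divisor plus one chip at each non-root vertex
(`bernardiDivisor_add`). Hence the Bernardi classes of T and T' differ by the class of the boundary
of the chain O(T, d₀) - O(T', d₀).

Duality is then nearly tautological. The dual tour of the complement of T is the tour of T with all
darts reversed (`dual_tourStep_compl_iterate`), so both trees carry the same orientation and the
difference chains correspond under c ↦ c*. What remains is that the difference chain is independent
of the start modulo flows and cuts. Moving the start from d to `next d` changes O by the chain of d,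
which does not depend on the tree and cancels in differences, plus a cut (`tourOrientation_next`).
The same fact in the dual, whose rotation is `rev ∘ next`, permits replacing d by `rev d`; rotations
and reversals link all darts (`mk_diff_eq`).

Injectivity of the Bernardi map: everything is reachable from the root along O, which forces
linearly equivalent indegrees to be equal (`ReachesAll.headSum_eq`); equal indegrees force equal
trees, by examining the fundamental cut at the first edge where the tours part
(`mem_of_headSum_eq`). Surjectivity: reversing directed paths and cuts represents every class of the
right degree by the indegrees of an orientation with everything reachable from the root. A tree with
these indegrees is built greedily along its own tour, discarding an edge whenever some compatible
orientation allows it. Exchanges in fundamental cuts of the tree or of the dual tree keep the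
construction going; a failed exchange yields a directed cut, excluded by reachability, or a directed
dual cut, that is, a family of darts reversible without changing indegrees, excluded by greediness
(`Greedy.exists_succ`).

Planarity enters by Euler's formula, which makes the complement of a tree a dual tree, and so
exchanges flows with dual cuts. -/

namespace RibbonGraph

/-! ### Darts, reachability, fundamental cuts and existence of spanning trees -/

section Basic

variable {V D : Type*} (G : RibbonGraph V D)

@[simp] lemma rev_rev' (d : D) : G.rev (G.rev d) = d := G.rev_rev d

lemma rev_injective : Function.Injective G.rev := fun a b h => by
  rw [← G.rev_rev a, h, G.rev_rev]

@[simp] lemma rev_inj {a b : D} : G.rev a = G.rev b ↔ a = b := G.rev_injective.eq_iff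

lemma rev_eq_iff {a b : D} : G.rev a = b ↔ a = G.rev b := by
  rw [← G.rev_inj, G.rev_rev]

@[simp] lemma tail_rev (d : D) : G.tail (G.rev d) = G.head d := rfl

@[simp] lemma head_rev (d : D) : G.head (G.rev d) = G.tail d := by
  simp [head]

@[simp] lemma tail_next (d : D) : G.tail (G.next d) = G.tail d :=
  ((G.sameCycle_iff d (G.next d)).1 ⟨1, by simp⟩).symm

@[simp] lemma dual_rev (d : D) : G.dual.rev d = G.rev d := rfl

lemma dual_next (d : D) : G.dual.next d = G.rev (G.next d) := rfl

/-- Being closed under reversal. -/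
def RevClosed (A : Set D) : Prop := ∀ d ∈ A, G.rev d ∈ A

variable {G}

lemma RevClosed.iff {A : Set D} (hA : G.RevClosed A) (d : D) : G.rev d ∈ A ↔ d ∈ A :=
  ⟨fun h => by simpa using hA _ h, hA d⟩

lemma RevClosed.compl {A : Set D} (hA : G.RevClosed A) : G.RevClosed Aᶜ := fun d hd h =>
  hd ((hA.iff d).1 h)

lemma RevClosed.diff_edge {A : Set D} (hA : G.RevClosed A) (a : D) :
    G.RevClosed (A \ {a, G.rev a}) := by
  rintro d ⟨hd, hne⟩
  refine ⟨hA d hd, fun h => hne ?_⟩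
  rcases h with h | h
  · right; simpa [G.rev_eq_iff] using h
  · left; exact G.rev_injective h

lemma RevClosed.union {A B : Set D} (hA : G.RevClosed A) (hB : G.RevClosed B) :
    G.RevClosed (A ∪ B) := fun d hd => hd.imp (hA d) (hB d)

variable (G) in
lemma revClosed_edge (a : D) : G.RevClosed {a, G.rev a} := by
  rintro d (rfl | rfl) <;> simp

lemma IsSpanningTree.revClosed {T : Set D} (hT : G.IsSpanningTree T) : G.RevClosed T :=
  hT.rev_mem

lemma Reachable.refl {A : Set D} (u : V) : G.Reachable A u u := Relation.ReflTransGen.refl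

lemma Reachable.trans {A : Set D} {u v w : V} (h : G.Reachable A u v) (h' : G.Reachable A v w) :
    G.Reachable A u w := Relation.ReflTransGen.trans h h'

lemma Reachable.single {A : Set D} {d : D} (hd : d ∈ A) : G.Reachable A (G.tail d) (G.head d) :=
  Relation.ReflTransGen.single ⟨d, hd, rfl, rfl⟩

lemma Reachable.symm {A : Set D} (hA : G.RevClosed A) {u v : V} (h : G.Reachable A u v) :
    G.Reachable A v u := by
  induction h with
  | refl => exact .refl _
  | tail _ h ih =>
    obtain ⟨d, hd, rfl, rfl⟩ := h
    have := Reachable.single (G := G) (hA d hd)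
    simp only [tail_rev, head_rev] at this
    exact this.trans ih

lemma Reachable.of_step {A B : Set D} (hAB : ∀ d ∈ A, G.Reachable B (G.tail d) (G.head d))
    {u v : V} (h : G.Reachable A u v) : G.Reachable B u v := by
  induction h with
  | refl => exact .refl _
  | tail _ h ih =>
    obtain ⟨d, hd, rfl, rfl⟩ := h
    exact ih.trans (hAB d hd)

lemma Reachable.mono {A B : Set D} (hAB : A ⊆ B) {u v : V} (h : G.Reachable A u v) :
    G.Reachable B u v := h.of_step fun _ hd => .single (hAB hd)

/-- A path from outside `X` into `X` enters `X` along some dart. -/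
lemma Reachable.exists_entering {A : Set D} {u v : V} (h : G.Reachable A u v) {X : Set V}
    (hu : u ∉ X) (hv : v ∈ X) : ∃ d ∈ A, G.tail d ∉ X ∧ G.head d ∈ X := by
  induction h with
  | refl => exact absurd hv hu
  | @tail x y _ h ih =>
    obtain ⟨d, hd, rfl, rfl⟩ := h
    by_cases hx : G.tail d ∈ X
    · exact ih hx
    · exact ⟨d, hd, hx, hv⟩

lemma tail_surjective [Nonempty D] (hG : G.Connected) : Function.Surjective G.tail := by
  intro v
  obtain ⟨d⟩ := ‹Nonempty D›
  by_cases h : G.tail d = v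
  · exact ⟨d, h⟩
  · obtain ⟨e, -, -, he⟩ := (hG.2 (G.tail d) v).exists_entering (X := {v}) h rfl
    exact ⟨G.rev e, he⟩

/-! Fundamental cuts of a spanning tree -/

variable (G) in
/-- The vertices joined to the head of `a` by a path in `T` avoiding the edge of `a`. -/
def farSide (T : Set D) (a : D) : Set V :=
  {v | G.Reachable (T \ {a, G.rev a}) (G.head a) v}

lemma head_mem_farSide (T : Set D) (a : D) : G.head a ∈ G.farSide T a := Reachable.refl _

namespace IsSpanningTree

variable {T : Set D} (hT : G.IsSpanningTree T)
include hT

lemma tail_notMem_farSide {a : D} (ha : a ∈ T) : G.tail a ∉ G.farSide T a := fun h =>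
  hT.acyclic a ha (Reachable.symm (hT.revClosed.diff_edge a) h)

lemma farSide_iff {a b : D} (hb : b ∈ T) (h1 : b ≠ a) (h2 : b ≠ G.rev a) :
    G.tail b ∈ G.farSide T a ↔ G.head b ∈ G.farSide T a := by
  have hb' : b ∈ T \ {a, G.rev a} := ⟨hb, by rintro (h | h) <;> contradiction⟩
  have hs := Reachable.single (G := G) hb'
  exact ⟨fun h => Reachable.trans h hs,
    fun h => Reachable.trans h (hs.symm (hT.revClosed.diff_edge a))⟩

lemma eq_of_entering {a b : D} (ha : a ∈ T) (hb : b ∈ T) (h1 : G.tail b ∉ G.farSide T a)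
    (h2 : G.head b ∈ G.farSide T a) : b = a := by
  by_contra h
  by_cases h' : b = G.rev a
  · subst h'
    rw [head_rev] at h2
    exact hT.tail_notMem_farSide ha h2
  · exact h1 ((hT.farSide_iff hb h h').2 h2)

lemma eq_of_leaving {a b : D} (ha : a ∈ T) (hb : b ∈ T) (h1 : G.tail b ∈ G.farSide T a)
    (h2 : G.head b ∉ G.farSide T a) : b = G.rev a := by
  rw [← rev_eq_iff]
  exact hT.eq_of_entering ha (hT.rev_mem b hb) (by simpa using h2) (by simpa using h1)

lemma reachable_tail_of_notMem_farSide {a : D} {v : V} (hv : v ∉ G.farSide T a) :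
    G.Reachable (T \ {a, G.rev a}) (G.tail a) v := by
  have key : ∀ {v}, G.Reachable T (G.head a) v → v ∈ G.farSide T a ∨
      G.Reachable (T \ {a, G.rev a}) (G.tail a) v := by
    intro v h
    induction h with
    | refl => exact .inl (head_mem_farSide T a)
    | tail _ h ih =>
      obtain ⟨d, hd, rfl, rfl⟩ := h
      by_cases h1 : d = a
      · subst h1; exact .inl (head_mem_farSide T d)
      by_cases h2 : d = G.rev a
      · subst h2; rw [head_rev]; exact .inr (.refl _)
      have hs : G.Reachable (T \ {a, G.rev a}) (G.tail d) (G.head d) :=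
        .single ⟨hd, by rintro (h | h) <;> contradiction⟩
      exact ih.imp (fun h => Reachable.trans h hs) (fun h => h.trans hs)
  exact (key (hT.connected.2 _ v)).resolve_left hv

end IsSpanningTree

lemma ConnectedOn.of_forall_reachable {A : Set D} (hA : G.RevClosed A) {u : V}
    (h : ∀ v, G.Reachable A u v) : G.ConnectedOn A :=
  ⟨⟨u⟩, fun v w => ((h v).symm hA).trans (h w)⟩

/-- A connected set of edges contains a spanning tree. -/
lemma ConnectedOn.exists_isSpanningTree [Finite D] {A : Set D} (hA : G.RevClosed A)
    (hc : G.ConnectedOn A) : ∃ T ⊆ A, G.IsSpanningTree T := by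
  induction hn : A.ncard using Nat.strong_induction_on generalizing A with
  | _ n ih =>
    by_cases hac : ∀ d ∈ A, ¬ G.Reachable (A \ {d, G.rev d}) (G.tail d) (G.head d)
    · exact ⟨A, subset_rfl, hA, hc, hac⟩
    · push Not at hac
      obtain ⟨d, hd, hr⟩ := hac
      have hA' := hA.diff_edge d
      -- An edge whose ends stay joined without it can be deleted: a path through it is rerouted.
      have hc' : G.ConnectedOn (A \ {d, G.rev d}) := by
        refine ⟨hc.1, fun u v => (hc.2 u v).of_step fun b hb => ?_⟩
        by_cases h1 : b = d
        · subst h1; exact hr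
        by_cases h2 : b = G.rev d
        · subst h2; simpa using hr.symm hA'
        exact .single ⟨hb, by rintro (h | h) <;> contradiction⟩
      have hlt : (A \ {d, G.rev d}).ncard < n := by
        rw [← hn]
        exact Set.ncard_lt_ncard ⟨Set.sdiff_subset, fun h => (h hd).2 (.inl rfl)⟩
      obtain ⟨T, hTA, hT⟩ := ih _ hlt hA' hc' rfl
      exact ⟨T, hTA.trans Set.sdiff_subset, hT⟩

end Basic

/-! ### The tour as a permutation of the darts, and its dual -/

section Tour

variable {V D : Type*} {G : RibbonGraph V D} {T : Set D}

lemma tourStep_of_mem {d : D} (h : d ∈ T) : G.tourStep T d = G.next (G.rev d) := if_pos h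

lemma tourStep_of_notMem {d : D} (h : d ∉ T) : G.tourStep T d = G.next d := if_neg h

lemma tourStep_injective (hT : G.RevClosed T) : Function.Injective (G.tourStep T) := by
  intro a b h
  by_cases ha : a ∈ T <;> by_cases hb : b ∈ T
  · simpa [tourStep_of_mem, ha, hb] using h
  · simp only [tourStep_of_mem ha, tourStep_of_notMem hb, EmbeddingLike.apply_eq_iff_eq] at h
    exact absurd (h ▸ hT a ha) hb
  · simp only [tourStep_of_mem hb, tourStep_of_notMem ha, EmbeddingLike.apply_eq_iff_eq] at h
    exact absurd (h ▸ hT b hb) ha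
  · simpa [tourStep_of_notMem, ha, hb] using h

lemma tail_tourStep_of_mem {d : D} (h : d ∈ T) : G.tail (G.tourStep T d) = G.head d := by
  simp [tourStep_of_mem h]

lemma tail_tourStep_of_notMem {d : D} (h : d ∉ T) : G.tail (G.tourStep T d) = G.tail d := by
  simp [tourStep_of_notMem h]

/-- Complementing T swaps walking and cutting, and this is compensated by the extra `rev` in the
dual rotation. Tours of T and of its complement in the dual are therefore conjugate by `rev`. -/
lemma dual_tourStep_compl (hT : G.RevClosed T) (d : D) :
    G.dual.tourStep Tᶜ d = G.rev (G.tourStep T (G.rev d)) := by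
  by_cases h : d ∈ T
  · rw [tourStep_of_notMem (by simpa using h), tourStep_of_mem (hT d h), rev_rev', dual_next]
  · rw [tourStep_of_mem (by simpa using h), tourStep_of_notMem (by rwa [hT.iff]), dual_next,
      dual_rev]

lemma dual_tourStep_compl_iterate (hT : G.RevClosed T) (n : ℕ) (d : D) :
    (G.dual.tourStep Tᶜ)^[n] (G.rev d) = G.rev ((G.tourStep T)^[n] d) := by
  induction n with
  | zero => rfl
  | succ n ih =>
    rw [Function.iterate_succ_apply', ih, dual_tourStep_compl hT, rev_rev',
      Function.iterate_succ_apply']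

variable (G) in
/-- The tour around `T` visits all darts. -/
def TourTransitive (T : Set D) : Prop := ∀ d d' : D, ∃ n : ℕ, (G.tourStep T)^[n] d = d'

lemma dual_tourTransitive_iff (hT : G.RevClosed T) :
    G.dual.TourTransitive Tᶜ ↔ G.TourTransitive T := by
  constructor
  · intro h d d'
    obtain ⟨n, hn⟩ := h (G.rev d) (G.rev d')
    rw [dual_tourStep_compl_iterate hT] at hn
    exact ⟨n, G.rev_injective hn⟩
  · intro h d d'
    obtain ⟨n, hn⟩ := h (G.rev d) (G.rev d')
    refine ⟨n, ?_⟩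
    have := dual_tourStep_compl_iterate hT n (G.rev d)
    rw [rev_rev'] at this
    rw [this, hn, rev_rev']

/-- The tour changes vertex only along edges of T, so a tour visiting all darts connects all
vertices inside T. -/
lemma TourTransitive.connectedOn [Nonempty D] (hT : G.RevClosed T) (h : G.TourTransitive T)
    (hs : Function.Surjective G.tail) : G.ConnectedOn T := by
  obtain ⟨d⟩ := ‹Nonempty D›
  refine ConnectedOn.of_forall_reachable hT (u := G.tail d) fun v => ?_
  obtain ⟨d', rfl⟩ := hs v
  obtain ⟨n, rfl⟩ := h d d'
  induction n with
  | zero => exact .refl _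
  | succ n ih =>
    rw [Function.iterate_succ_apply']
    set b := (G.tourStep T)^[n] d
    by_cases hb : b ∈ T
    · rw [tail_tourStep_of_mem hb]
      exact ih.trans (.single hb)
    · rwa [tail_tourStep_of_notMem hb]

namespace IsSpanningTree

variable (hT : G.IsSpanningTree T)
include hT

lemma tail_tourStep_mem_farSide {a b : D} (ha : a ∈ T) (hb : b ≠ G.rev a)
    (h : G.tail b ∈ G.farSide T a) : G.tail (G.tourStep T b) ∈ G.farSide T a := by
  by_cases hbT : b ∈ T
  · rw [tail_tourStep_of_mem hbT]
    by_contra h'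
    exact hb (hT.eq_of_leaving ha hbT h h')
  · rwa [tail_tourStep_of_notMem hbT]

lemma tail_tourStep_notMem_farSide {a b : D} (ha : a ∈ T) (hb : b ≠ a)
    (h : G.tail b ∉ G.farSide T a) : G.tail (G.tourStep T b) ∉ G.farSide T a := by
  by_cases hbT : b ∈ T
  · rw [tail_tourStep_of_mem hbT]
    exact fun h' => hb (hT.eq_of_entering ha hbT h h')
  · rwa [tail_tourStep_of_notMem hbT]

/-- After walking along `a` the tour is on the far side of `a`, which it can leave only through `rev
a`; since the tour is periodic, it must leave. -/
lemma exists_iterate_eq_rev [Finite D] {a : D} (ha : a ∈ T) :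
    ∃ n : ℕ, (G.tourStep T)^[n] a = G.rev a := by
  by_contra! hne
  have hp : a ∈ Function.periodicPts (G.tourStep T) :=
    (tourStep_injective hT.revClosed).mem_periodicPts a
  obtain ⟨k, hk, hka⟩ := hp
  have key : ∀ n : ℕ, G.tail ((G.tourStep T)^[n + 1] a) ∈ G.farSide T a := by
    intro n
    induction n with
    | zero =>
      simpa [tail_tourStep_of_mem ha] using head_mem_farSide (G := G) T a
    | succ n ih =>
      rw [Function.iterate_succ_apply']
      exact hT.tail_tourStep_mem_farSide ha (hne _) ih
  have := key (k - 1)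
  rw [Nat.sub_add_cancel hk, hka.eq] at this
  exact hT.tail_notMem_farSide ha this

/-- The orbit of a dart is closed under rotation at its vertex and under reversal of tree edges, and
these moves link all darts because T is connected. -/
theorem tourTransitive [Finite D] : G.TourTransitive T := by
  have htrans : ∀ {a b c : D}, (∃ n, (G.tourStep T)^[n] a = b) → (∃ n, (G.tourStep T)^[n] b = c) →
      ∃ n, (G.tourStep T)^[n] a = c := by
    rintro a b c ⟨n, rfl⟩ ⟨m, rfl⟩
    exact ⟨m + n, Function.iterate_add_apply _ _ _ _⟩
  have hnext : ∀ a, ∃ n, (G.tourStep T)^[n] a = G.next a := by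
    intro a
    by_cases ha : a ∈ T
    -- On coming back through `rev a`, the next dart considered is the one after `a`.
    · refine htrans (hT.exists_iterate_eq_rev ha) ⟨1, ?_⟩
      simp [tourStep_of_mem (hT.rev_mem a ha)]
    · exact ⟨1, by simp [tourStep_of_notMem ha]⟩
  have hsame : ∀ a b, G.tail a = G.tail b → ∃ n, (G.tourStep T)^[n] a = b := by
    intro a b hab
    obtain ⟨k, hk⟩ := ((G.sameCycle_iff a b).2 hab).exists_nat_pow_eq
    subst hk
    induction k with
    | zero => exact ⟨0, rfl⟩
    | succ k ih =>
      rw [pow_succ', Equiv.Perm.mul_apply]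
      exact htrans (ih ((G.sameCycle_iff _ _).1 ⟨k, by simp⟩)) (hnext _)
  have hreach : ∀ {u v}, G.Reachable T u v → ∀ a b, G.tail a = u → G.tail b = v →
      ∃ n, (G.tourStep T)^[n] a = b := by
    intro u v h
    induction h with
    | refl => exact fun a b ha hb => hsame a b (ha.trans hb.symm)
    | tail _ h ih =>
      obtain ⟨d, hd, rfl, rfl⟩ := h
      intro a b ha hb
      exact htrans (ih a d ha rfl) (htrans (hT.exists_iterate_eq_rev hd)
        (hsame _ _ (by simpa using hb.symm)))
  exact fun a b => hreach (hT.connected.2 _ _) a b rfl rfl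

end IsSpanningTree

end Tour

/-! ### Visiting times and the orientation attached to a tree -/

section TourTime

variable {V D : Type*} {G : RibbonGraph V D} {T T' : Set D} {d₀ : D}

variable (G) in
/-- The number of steps after which the tour of `T` started at `d₀` first considers `d`. -/
noncomputable def tourTime (T : Set D) (d₀ d : D) : ℕ := sInf {n | (G.tourStep T)^[n] d₀ = d}

lemma tourTime_le {n : ℕ} {d : D} (h : (G.tourStep T)^[n] d₀ = d) : G.tourTime T d₀ d ≤ n :=
  Nat.sInf_le h

@[simp] lemma tourTime_self : G.tourTime T d₀ d₀ = 0 := Nat.le_zero.1 (tourTime_le rfl)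

lemma dual_tourTime (hT : G.RevClosed T) (d₀ d : D) :
    G.dual.tourTime Tᶜ (G.rev d₀) d = G.tourTime T d₀ (G.rev d) := by
  unfold tourTime
  congr 1
  ext n
  simp only [Set.mem_ofPred_eq]
  rw [dual_tourStep_compl_iterate hT, G.rev_eq_iff]

variable (G) in
open Classical in
/-- The orientation attached to a spanning tree and a start of the tour: the edges of the tree are
oriented as they are first walked along, the other edges point to the vertex from which they are
first cut through.  The value is `1` on the darts that are oriented positively, and `0` on the
reversals of these. -/
noncomputable def tourOrientation (d₀ : D) (T : Set D) (d : D) : ℤ :=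
  if (d ∈ T ↔ G.tourTime T d₀ d < G.tourTime T d₀ (G.rev d)) then 1 else 0

variable (G) in
/-- `o` is the indicator function of a choice of one dart of each edge. -/
def IsOrientation (o : D → ℤ) : Prop := ∀ d, (o d = 0 ∨ o d = 1) ∧ o d + o (G.rev d) = 1

/-- Passing to the dual negates both membership in the tree and the order of the two visits to an
edge, so their equivalence is unchanged. -/
lemma dual_tourOrientation (hT : G.RevClosed T) (d₀ : D)
    (hne : ∀ d, G.tourTime T d₀ d ≠ G.tourTime T d₀ (G.rev d)) :
    G.dual.tourOrientation (G.rev d₀) Tᶜ = G.tourOrientation d₀ T := by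
  funext d
  unfold tourOrientation
  congr 1
  simp only [dual_tourTime hT, dual_rev, rev_rev', Set.mem_compl_iff, eq_iff_iff]
  have := hne d
  by_cases h : d ∈ T <;> simp [h] <;> omega

lemma tourOrientation_eq_one_iff_of_mem {a : D} (ha : a ∈ T) :
    G.tourOrientation d₀ T a = 1 ↔ G.tourTime T d₀ a < G.tourTime T d₀ (G.rev a) := by
  simp [tourOrientation, ha]

/-- The position at time k depends only on membership of the darts considered before time k. This
lets a tree be modified later in the tour without disturbing its beginning. -/
lemma tourStep_iterate_congr {n : ℕ} (h : ∀ b, G.tourTime T d₀ b < n → (b ∈ T ↔ b ∈ T')) :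
    ∀ k ≤ n, (G.tourStep T')^[k] d₀ = (G.tourStep T)^[k] d₀ := by
  intro k hk
  induction k with
  | zero => rfl
  | succ k ih =>
    rw [Function.iterate_succ_apply', Function.iterate_succ_apply', ih (by omega)]
    set b := (G.tourStep T)^[k] d₀ with hb
    have hbt : G.tourTime T d₀ b < n := (tourTime_le hb.symm).trans_lt (by omega)
    have := h b hbt
    by_cases hbT : b ∈ T
    · rw [tourStep_of_mem hbT, tourStep_of_mem (this.1 hbT)]
    · rw [tourStep_of_notMem hbT, tourStep_of_notMem (fun h' => hbT (this.2 h'))]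

namespace IsSpanningTree

variable [Finite D] (hT : G.IsSpanningTree T) (hT' : G.IsSpanningTree T')

include hT in
lemma iterate_tourTime (d₀ d : D) : (G.tourStep T)^[G.tourTime T d₀ d] d₀ = d :=
  Nat.sInf_mem (s := {n | (G.tourStep T)^[n] d₀ = d}) (hT.tourTransitive d₀ d)

include hT in
lemma tourTime_inj {d d' : D} : G.tourTime T d₀ d = G.tourTime T d₀ d' ↔ d = d' :=
  ⟨fun h => by rw [← hT.iterate_tourTime d₀ d, h, hT.iterate_tourTime], fun h => by rw [h]⟩

include hT in
lemma tourTime_ne_rev (d₀ d : D) : G.tourTime T d₀ d ≠ G.tourTime T d₀ (G.rev d) :=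
  fun h => G.rev_ne d (hT.tourTime_inj.1 h).symm

include hT in
lemma tourTime_eq_iff {d : D} {n : ℕ} : G.tourTime T d₀ d = n ↔
    (G.tourStep T)^[n] d₀ = d ∧ ∀ m < n, (G.tourStep T)^[m] d₀ ≠ d := by
  constructor
  · rintro rfl
    exact ⟨hT.iterate_tourTime _ _, fun m hm h => (tourTime_le h).not_gt hm⟩
  · rintro ⟨h1, h2⟩
    refine (tourTime_le h1).antisymm ?_
    by_contra! h
    exact h2 _ h (hT.iterate_tourTime _ _)

include hT in
lemma tourTime_iterate {d : D} {n : ℕ} (hn : n ≤ G.tourTime T d₀ d) :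
    G.tourTime T d₀ ((G.tourStep T)^[n] d₀) = n := by
  rw [hT.tourTime_eq_iff]
  refine ⟨rfl, fun m hm h => ?_⟩
  have h1 : (G.tourStep T)^[G.tourTime T d₀ d - n + m] d₀ = d := by
    rw [Function.iterate_add_apply, h, ← Function.iterate_add_apply, Nat.sub_add_cancel hn,
      hT.iterate_tourTime]
  have := tourTime_le h1
  omega

include hT in
lemma metFirst_iff {d : D} :
    G.MetFirst d₀ T d ↔ G.tourTime T d₀ d < G.tourTime T d₀ (G.rev d) := by
  constructor
  · rintro ⟨n, hn, hm⟩
    refine lt_of_le_of_ne ?_ (hT.tourTime_ne_rev d₀ d)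
    refine (tourTime_le hn).trans ?_
    by_contra! h
    exact hm _ h (hT.iterate_tourTime _ _)
  · intro h
    exact ⟨_, hT.iterate_tourTime _ _, fun m hm h' =>
      absurd (tourTime_le h') (by omega)⟩

include hT in
/-- The part of the tour spent on the far side of a tree edge is the interval between the passages
through that edge. -/
lemma tourTime_farSide {a d : D} (ha : a ∈ T) (h0 : G.tail d₀ ∉ G.farSide T a) :
    G.tail d ∈ G.farSide T a ↔ G.tourTime T d₀ a < G.tourTime T d₀ d ∧
      G.tourTime T d₀ d ≤ G.tourTime T d₀ (G.rev a) := by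
  set X := G.farSide T a
  set t := G.tourTime T d₀ with ht
  have before : ∀ m ≤ t a, G.tail ((G.tourStep T)^[m] d₀) ∉ X := by
    intro m hm
    induction m with
    | zero => exact h0
    | succ m ih =>
      rw [Function.iterate_succ_apply']
      refine hT.tail_tourStep_notMem_farSide ha (fun h => ?_) (ih (by omega))
      have : t _ ≤ _ := tourTime_le h
      omega
  have hrev : t a < t (G.rev a) := by
    by_contra! h
    refine before _ h ?_
    rw [ht, hT.iterate_tourTime]
    exact head_mem_farSide T a
  have inside : ∀ m, t a + 1 ≤ m → m ≤ t (G.rev a) → G.tail ((G.tourStep T)^[m] d₀) ∈ X := by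
    intro m hm
    induction m, hm using Nat.le_induction with
    | base =>
      intro _
      rw [Function.iterate_succ_apply', ht, hT.iterate_tourTime, tail_tourStep_of_mem ha]
      exact head_mem_farSide T a
    | succ m hm ih =>
      intro hm'
      rw [Function.iterate_succ_apply']
      refine hT.tail_tourStep_mem_farSide ha (fun h => ?_) (ih (by omega))
      have : t _ ≤ _ := tourTime_le h
      omega
  have after : ∀ m, t (G.rev a) + 1 ≤ m → m ≤ t d → G.tail ((G.tourStep T)^[m] d₀) ∉ X := by
    intro m hm
    induction m, hm using Nat.le_induction with
    | base =>
      intro _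
      rw [Function.iterate_succ_apply', ht, hT.iterate_tourTime,
        tail_tourStep_of_mem (hT.rev_mem a ha), head_rev]
      exact hT.tail_notMem_farSide ha
    | succ m hm ih =>
      intro hm'
      rw [Function.iterate_succ_apply']
      refine hT.tail_tourStep_notMem_farSide ha (fun h => ?_) (ih (by omega))
      -- Until d is first reached no dart repeats, so the tour cannot pass through `a` again and
      -- re-enter the far side.
      have : t _ = _ := hT.tourTime_iterate (d := d) (n := m) (Nat.le_of_succ_le hm')
      rw [h] at this
      omega
  have hd : (G.tourStep T)^[t d] d₀ = d := hT.iterate_tourTime d₀ d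
  constructor
  · intro h
    constructor
    · by_contra! h'
      exact before _ h' (by rwa [hd])
    · by_contra! h'
      exact after _ h' le_rfl (by rwa [hd])
  · rintro ⟨h1, h2⟩
    have := inside _ h1 h2
    rwa [hd] at this

include hT in
lemma tourTime_lt_rev_iff {a : D} (ha : a ∈ T) :
    G.tourTime T d₀ a < G.tourTime T d₀ (G.rev a) ↔ G.tail d₀ ∉ G.farSide T a := by
  constructor
  · intro h h0
    have hk : ∀ m ≤ G.tourTime T d₀ a, G.tail ((G.tourStep T)^[m] d₀) ∈ G.farSide T a := by
      intro m hm
      induction m with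
      | zero => exact h0
      | succ m ih =>
        rw [Function.iterate_succ_apply']
        refine hT.tail_tourStep_mem_farSide ha (fun h' => ?_) (ih (by omega))
        have := tourTime_le h'
        omega
    have := hk _ le_rfl
    rw [hT.iterate_tourTime] at this
    exact hT.tail_notMem_farSide ha this
  · intro h0
    exact ((hT.tourTime_farSide (d := G.rev a) ha h0).1 (head_mem_farSide T a)).1

include hT hT' in
lemma tourTime_congr {n : ℕ} (h : ∀ b, G.tourTime T d₀ b < n → (b ∈ T ↔ b ∈ T')) {k : ℕ}
    (hk : k ≤ n) (b : D) : G.tourTime T' d₀ b = k ↔ G.tourTime T d₀ b = k := by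
  have key := tourStep_iterate_congr h
  rw [hT.tourTime_eq_iff, hT'.tourTime_eq_iff, key k hk]
  refine and_congr_right fun _ => forall₂_congr fun m hm => ?_
  rw [key m (by omega)]

-- The bound is `n + 1` because agreement on the darts considered before time n already fixes the
-- position at time n itself.
include hT hT' in
lemma tourTime_lt_congr {n : ℕ} (h : ∀ b, G.tourTime T d₀ b < n → (b ∈ T ↔ b ∈ T')) {k : ℕ}
    (hk : k ≤ n + 1) (b : D) : G.tourTime T' d₀ b < k ↔ G.tourTime T d₀ b < k :=
  ⟨fun hb => ((tourTime_congr hT hT' h (by omega) b).1 rfl).trans_lt hb,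
    fun hb => ((tourTime_congr hT hT' h (by omega) b).2 rfl).trans_lt hb⟩

include hT in
lemma isOrientation_tourOrientation (d₀ : D) : G.IsOrientation (G.tourOrientation d₀ T) := by
  intro d
  have hne := hT.tourTime_ne_rev d₀ d
  have hm := hT.revClosed.iff d
  unfold tourOrientation
  rw [rev_rev', hm]
  constructor
  · split_ifs <;> simp
  · by_cases h : d ∈ T <;> by_cases h' : G.tourTime T d₀ d < G.tourTime T d₀ (G.rev d)
    · simp [h, h', h'.le]
    · have : G.tourTime T d₀ (G.rev d) < G.tourTime T d₀ d := by omega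
      simp [h, h', this]
    · simp [h, h', h'.le]
    · have : G.tourTime T d₀ (G.rev d) < G.tourTime T d₀ d := by omega
      simp [h, h', this]

include hT in
lemma dual_tourOrientation (d₀ : D) :
    G.dual.tourOrientation (G.rev d₀) Tᶜ = G.tourOrientation d₀ T :=
  RibbonGraph.dual_tourOrientation hT.revClosed d₀ (hT.tourTime_ne_rev d₀)

include hT hT' in
lemma tourOrientation_congr {n : ℕ} (h : ∀ b, G.tourTime T d₀ b < n → (b ∈ T ↔ b ∈ T')) {b : D}
    (hb : G.tourTime T d₀ b < n ∨ G.tourTime T d₀ (G.rev b) < n) :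
    G.tourOrientation d₀ T' b = G.tourOrientation d₀ T b := by
  wlog hb' : G.tourTime T d₀ b < n generalizing b
  · have h1 := (hT.isOrientation_tourOrientation d₀ b).2
    have h2 := (hT'.isOrientation_tourOrientation d₀ b).2
    have h3 := this (b := G.rev b) (by simpa using hb.symm) (hb.resolve_left hb')
    linarith
  have e1 : G.tourTime T' d₀ b = G.tourTime T d₀ b := (tourTime_congr hT hT' h hb'.le b).2 rfl
  have e2 := tourTime_lt_congr hT hT' h (k := G.tourTime T d₀ b) (by omega) (G.rev b)
  have hne := hT.tourTime_ne_rev d₀ b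
  have hne' := hT'.tourTime_ne_rev d₀ b
  have e3 : (G.tourTime T' d₀ b < G.tourTime T' d₀ (G.rev b)) ↔
      (G.tourTime T d₀ b < G.tourTime T d₀ (G.rev b)) := by omega
  unfold tourOrientation
  classical
  exact if_congr (by rw [e3, h b hb']) rfl rfl

end IsSpanningTree

namespace IsOrientation

variable {o : D → ℤ} (ho : G.IsOrientation o)
include ho

lemma rev_eq (d : D) : o (G.rev d) = 1 - o d := by linarith [(ho d).2]

lemma nonneg (d : D) : 0 ≤ o d := by rcases (ho d).1 with h | h <;> simp [h]

lemma le_one (d : D) : o d ≤ 1 := by rcases (ho d).1 with h | h <;> simp [h]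

end IsOrientation

namespace IsSpanningTree

variable [Finite D] (hT : G.IsSpanningTree T)
include hT

lemma tourOrientation_eq_one_iff_of_notMem {a : D} (ha : a ∉ T) :
    G.tourOrientation d₀ T a = 1 ↔ G.tourTime T d₀ (G.rev a) < G.tourTime T d₀ a := by
  have := hT.tourTime_ne_rev d₀ a
  simp only [tourOrientation, ha, false_iff, ite_eq_left_iff, zero_ne_one, imp_false, not_not]
  omega

/-- Every vertex other than the root is first reached through a unique tree edge. -/
lemma existsUnique_mem_head_eq {v : V} (hs : Function.Surjective G.tail) (hv : v ≠ G.tail d₀) :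
    ∃! a, a ∈ T ∧ G.tourTime T d₀ a < G.tourTime T d₀ (G.rev a) ∧ G.head a = v := by
  obtain ⟨d, hd⟩ := hs v
  have hex : ∃ n : ℕ, G.tail ((G.tourStep T)^[n] d₀) = v :=
    ⟨_, by rw [hT.iterate_tourTime d₀ d, hd]⟩
  classical
  have hmin : ∀ m < Nat.find hex, G.tail ((G.tourStep T)^[m] d₀) ≠ v :=
    fun m hm => Nat.find_min hex hm
  have hspec := Nat.find_spec hex
  obtain ⟨k, hk⟩ : ∃ k, Nat.find hex = k + 1 := by
    refine Nat.exists_eq_succ_of_ne_zero fun h => hv ?_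
    rw [h] at hspec
    exact hspec.symm
  rw [hk] at hmin hspec
  rw [Function.iterate_succ_apply'] at hspec
  set a := (G.tourStep T)^[k] d₀ with ha
  have haT : a ∈ T := by
    by_contra h
    rw [tail_tourStep_of_notMem h] at hspec
    exact hmin k (by omega) hspec
  rw [tail_tourStep_of_mem haT] at hspec
  have hlt : G.tourTime T d₀ a < G.tourTime T d₀ (G.rev a) := by
    have h1 : G.tourTime T d₀ a ≤ k := tourTime_le rfl
    by_contra! h2
    refine hmin (G.tourTime T d₀ (G.rev a)) (by omega) ?_
    rw [hT.iterate_tourTime, tail_rev, hspec]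
  refine ⟨a, ⟨haT, hlt, hspec⟩, ?_⟩
  -- If two such edges a and b entered v, then a would start on the far side of b and be walked
  -- after b, and vice versa.
  · have aux : ∀ {a b : D}, a ∈ T → b ∈ T → G.tourTime T d₀ b < G.tourTime T d₀ (G.rev b) →
        G.head a = G.head b → a ≠ b → G.tourTime T d₀ b < G.tourTime T d₀ a := by
      intro a b ha hb hb' hab hne
      refine ((hT.tourTime_farSide hb ((hT.tourTime_lt_rev_iff hb).1 hb')).1 ?_).1
      by_contra h
      exact hne (hT.eq_of_entering hb ha h (hab ▸ head_mem_farSide T b))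
    rintro b ⟨hb, hb', hbv⟩
    by_contra hne
    have h1 := aux hb haT hlt (hbv.trans hspec.symm) hne
    have h2 := aux haT hb hb' (hspec.trans hbv.symm) (Ne.symm hne)
    omega

lemma tourTime_rev_lt_of_head_eq {a : D} (ha : a ∈ T) (h : G.head a = G.tail d₀) :
    ¬ G.tourTime T d₀ a < G.tourTime T d₀ (G.rev a) := by
  rw [hT.tourTime_lt_rev_iff ha, not_not, ← h]
  exact head_mem_farSide T a

end IsSpanningTree

end TourTime

/-! ### Indegrees, boundaries and the Bernardi divisor -/

section HeadSum

variable {V D : Type*} [Fintype D] {G : RibbonGraph V D}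

variable (G) in
open Classical in
/-- The function on the vertices obtained by summing `c` over the darts with a given head. -/
noncomputable def headSum (c : D → ℤ) (v : V) : ℤ :=
  ∑ d ∈ Finset.univ.filter (fun d => G.head d = v), c d

lemma boundary_eq_headSum (c : G.chains) : G.boundary c = G.headSum c.1 := rfl

omit [Fintype D] in
lemma coboundary_apply (f : V → ℤ) (d : D) :
    (G.coboundary f).1 d = f (G.head d) - f (G.tail d) := rfl

omit [Fintype D] in
lemma chains_apply_rev (c : G.chains) (d : D) : c.1 (G.rev d) = - c.1 d := c.2 d

lemma headSum_sub (c c' : D → ℤ) : G.headSum (c - c') = G.headSum c - G.headSum c' := by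
  funext v
  simp [headSum, Finset.sum_sub_distrib]

lemma headSum_add (c c' : D → ℤ) : G.headSum (c + c') = G.headSum c + G.headSum c' := by
  funext v
  simp [headSum, Finset.sum_add_distrib]

lemma sum_rev {M : Type*} [AddCommMonoid M] (F : D → M) : ∑ d, F (G.rev d) = ∑ d, F d :=
  Equiv.sum_comp G.revPerm F

lemma sum_mul_headSum [Fintype V] (f : V → ℤ) (c : D → ℤ) :
    ∑ v, f v * G.headSum c v = ∑ d, f (G.head d) * c d := by
  classical
  rw [← Finset.sum_fiberwise (s := Finset.univ) (g := G.head)]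
  refine Finset.sum_congr rfl fun v _ => ?_
  rw [headSum, Finset.mul_sum]
  refine Finset.sum_congr (by ext; simp) fun d hd => ?_
  rw [(Finset.mem_filter.1 hd).2]

lemma sum_headSum [Fintype V] (c : D → ℤ) : ∑ v, G.headSum c v = ∑ d, c d := by
  simpa using sum_mul_headSum (G := G) 1 c

/-- The coboundary is, up to a factor, adjoint to the boundary. -/
lemma sum_coboundary_mul [Fintype V] (f : V → ℤ) (c : G.chains) :
    ∑ d, (f (G.head d) - f (G.tail d)) * c.1 d = 2 * ∑ v, f v * G.boundary c v := by
  have h : ∑ d, f (G.tail d) * c.1 d = - ∑ d, f (G.head d) * c.1 d := by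
    rw [← sum_rev (G := G), ← Finset.sum_neg_distrib]
    refine Finset.sum_congr rfl fun d _ => ?_
    rw [tail_rev, chains_apply_rev]
    ring
  rw [boundary_eq_headSum, sum_mul_headSum]
  simp only [sub_mul, Finset.sum_sub_distrib, h]
  ring

lemma sum_boundary [Fintype V] (c : G.chains) : ∑ v, G.boundary c v = 0 := by
  have := sum_coboundary_mul (fun _ => 1) c
  simp at this
  exact this

lemma boundary_coboundary (f : V → ℤ) : G.boundary (G.coboundary f) = G.laplacian f := by
  classical
  funext v
  show ∑ d ∈ _, _ = ∑ d ∈ _, _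
  refine Finset.sum_bij' (fun d _ => G.rev d) (fun d _ => G.rev d) ?_ ?_ ?_ ?_ ?_
  · simp
  · simp
  · simp
  · simp
  · intro d hd
    simp only [Finset.mem_filter, Finset.mem_univ, true_and] at hd
    rw [coboundary_apply, hd, head_rev]

lemma mem_flows {c : G.chains} : c ∈ G.flows ↔ G.boundary c = 0 := Iff.rfl

namespace IsOrientation

variable {o o' : D → ℤ} (ho : G.IsOrientation o) (ho' : G.IsOrientation o')

/-- The difference of two orientations. -/
def diff : G.chains := ⟨o - o', fun d => by
  simp only [Pi.sub_apply, ho.rev_eq, ho'.rev_eq]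
  ring⟩

omit [Fintype D] in
lemma diff_apply (d : D) : (ho.diff ho').1 d = o d - o' d := rfl

lemma boundary_diff : G.boundary (ho.diff ho') = G.headSum o - G.headSum o' := headSum_sub o o'

include ho in
lemma two_mul_sum_mem {A : Set D} [DecidablePred (· ∈ A)] (hA : G.RevClosed A) :
    2 * ∑ d, (if d ∈ A then o d else 0) = A.ncard := by
  rw [two_mul]
  -- Each dart is paired with its reversal; on A the two values of `o` add up to 1.
  nth_rewrite 1 [← sum_rev (G := G)]
  rw [← Finset.sum_add_distrib, Set.ncard_eq_toFinset_card', Finset.card_eq_sum_ones,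
    Nat.cast_sum, ← Finset.sum_filter_add_sum_filter_not Finset.univ (· ∈ A)]
  have h2 : ∑ d with d ∉ A, ((if G.rev d ∈ A then o (G.rev d) else 0) +
      if d ∈ A then o d else 0) = 0 := by
    refine Finset.sum_eq_zero fun d hd => ?_
    have : d ∉ A := (Finset.mem_filter.1 hd).2
    simp [hA.iff, this]
  rw [h2, add_zero]
  refine Finset.sum_congr (by ext; simp) fun d hd => ?_
  have : d ∈ A := by simpa using hd
  simp only [hA.iff, this, if_true, Nat.cast_one]
  linarith [(ho d).2]

include ho in
lemma two_mul_sum : 2 * ∑ d, o d = Fintype.card D := by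
  classical
  have := ho.two_mul_sum_mem (A := Set.univ) (fun _ _ => trivial)
  simpa [Set.ncard_univ] using this

include ho in
lemma two_dvd_card : 2 ∣ Fintype.card D := by
  have := ho.two_mul_sum
  omega

end IsOrientation

omit [Fintype D] in
open Classical in
lemma sum_ne_root [Fintype V] (q : V) :
    ∑ v : V, (if v = q then (0 : ℤ) else 1) = Fintype.card V - 1 := by
  have : ∀ v : V, (if v = q then (0 : ℤ) else 1) = 1 - if v = q then 1 else 0 := by
    intro v; split_ifs <;> simp
  simp [this]

namespace IsSpanningTree

variable {T : Set D} {d₀ : D} (hT : G.IsSpanningTree T)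
include hT

-- Oriented by first passage, the tree is an arborescence directed away from the root.
open Classical in
lemma headSum_mem (hs : Function.Surjective G.tail) (d₀ : D) (v : V) :
    G.headSum (fun d => if d ∈ T then G.tourOrientation d₀ T d else 0) v =
      if v = G.tail d₀ then 0 else 1 := by
  have hval : ∀ d ∈ T, G.tourOrientation d₀ T d =
      if G.tourTime T d₀ d < G.tourTime T d₀ (G.rev d) then 1 else 0 := by
    intro d hd
    simp [tourOrientation, hd]
  unfold headSum
  split_ifs with hv
  · refine Finset.sum_eq_zero fun d hd => ?_
    have hd : G.head d = v := by simpa using hd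
    split_ifs with hdT
    · rw [hval d hdT, if_neg (hT.tourTime_rev_lt_of_head_eq hdT (hd.trans hv))]
    · rfl
  · obtain ⟨a, ⟨ha, ha', hav⟩, huniq⟩ := hT.existsUnique_mem_head_eq hs hv
    rw [Finset.sum_eq_single a]
    · rw [if_pos ha, hval a ha, if_pos ha']
    · intro b hb hne
      have hb : G.head b = v := by simpa using hb
      split_ifs with hbT
      · rw [hval b hbT, if_neg]
        exact fun h => hne (huniq b ⟨hbT, h, hb⟩)
      · rfl
    · intro h
      simp [hav] at h

/-- Obtained by summing tree indegrees over the vertices; an edge accounts for two darts of T. -/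
lemma ncard_add_two [Fintype V] [Nonempty D] (hs : Function.Surjective G.tail) :
    T.ncard + 2 = 2 * Fintype.card V := by
  classical
  obtain ⟨d₀⟩ := ‹Nonempty D›
  have h1 := (hT.isOrientation_tourOrientation d₀).two_mul_sum_mem hT.revClosed
  rw [← sum_headSum (G := G)] at h1
  simp only [hT.headSum_mem hs d₀] at h1
  rw [sum_ne_root] at h1
  omega

-- The Bernardi divisor counts the non-tree edges by the vertex they point to, and the indicator
-- function counts the tree edges.
open Classical in
lemma bernardiDivisor_add (hs : Function.Surjective G.tail) (d₀ : D) :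
    G.bernardiDivisor d₀ T + (fun v => if v = G.tail d₀ then 0 else 1) =
      G.headSum (G.tourOrientation d₀ T) := by
  have h1 : G.bernardiDivisor d₀ T =
      G.headSum (fun d => if d ∈ T then 0 else G.tourOrientation d₀ T d) := by
    funext v
    unfold bernardiDivisor headSum
    rw [Set.ncard_eq_toFinset_card', Finset.card_eq_sum_ones, Nat.cast_sum]
    -- A non-tree edge is cut first from the head of its positive dart, so the dart that is met
    -- first is the reversal of the positive one.
    have : ∀ d, (if d ∈ T then (0 : ℤ) else G.tourOrientation d₀ T d) =
        if d ∉ T ∧ G.MetFirst d₀ T (G.rev d) then 1 else 0 := by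
      intro d
      by_cases h : d ∈ T
      · simp [h]
      · have e := hT.tourOrientation_eq_one_iff_of_notMem (d₀ := d₀) h
        have e' := (hT.isOrientation_tourOrientation d₀ d).1
        simp only [h, if_false, not_false_eq_true, true_and, hT.metFirst_iff, rev_rev']
        split_ifs with h'
        · exact e.2 h'
        · exact e'.resolve_right (fun h'' => h' (e.1 h''))
    simp only [this]
    rw [← Finset.sum_filter, Finset.filter_filter]
    refine Finset.sum_bij' (fun d _ => G.rev d) (fun d _ => G.rev d) ?_ ?_ ?_ ?_ ?_
    · intro d hd
      simp only [Set.mem_toFinset, Set.mem_ofPred_eq] at hd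
      simp [hd, hT.revClosed.iff]
    · intro d hd
      simp only [Finset.mem_filter, Finset.mem_univ, true_and] at hd
      simp [hd, hT.revClosed.iff]
    · simp
    · simp
    · simp
  funext v
  have h2 := hT.headSum_mem hs d₀ v
  rw [h1, Pi.add_apply, ← h2, ← Pi.add_apply, ← headSum_add]
  congr 1
  funext d
  simp only [Pi.add_apply]
  split_ifs <;> simp

end IsSpanningTree

/-- A spanning tree inside A already has as many darts as A. -/
lemma ConnectedOn.isSpanningTree_of_ncard [Fintype V] [Nonempty D] {A : Set D}
    (hA : G.RevClosed A) (hc : G.ConnectedOn A) (hs : Function.Surjective G.tail)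
    (hn : A.ncard + 2 = 2 * Fintype.card V) : G.IsSpanningTree A := by
  obtain ⟨T, hTA, hT⟩ := hc.exists_isSpanningTree hA
  have := hT.ncard_add_two hs
  rwa [← Set.eq_of_subset_of_ncard_le hTA (by omega)]

/-- Exchanging an edge of a spanning tree against an edge of its fundamental cut. -/
lemma IsSpanningTree.exchange [Fintype V] [Nonempty D] {T : Set D} (hT : G.IsSpanningTree T)
    (hs : Function.Surjective G.tail) {a e : D} (ha : a ∈ T) (he : e ∉ T)
    (h1 : G.tail e ∉ G.farSide T a) (h2 : G.head e ∈ G.farSide T a) :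
    G.IsSpanningTree ((T \ {a, G.rev a}) ∪ {e, G.rev e}) := by
  have hR := (hT.revClosed.diff_edge a).union (G.revClosed_edge e)
  refine ConnectedOn.isSpanningTree_of_ncard hR ?_ hs ?_
  · have hstep : G.Reachable ((T \ {a, G.rev a}) ∪ {e, G.rev e}) (G.tail e) (G.head e) :=
      .single (by simp)
    have h3 : ∀ v ∈ G.farSide T a,
        G.Reachable ((T \ {a, G.rev a}) ∪ {e, G.rev e}) (G.head a) v := fun v hv =>
      Reachable.mono Set.subset_union_left hv
    refine ConnectedOn.of_forall_reachable hR (u := G.head a) fun v => ?_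
    by_cases hv : v ∈ G.farSide T a
    · exact h3 v hv
    · have h4 := (hT.reachable_tail_of_notMem_farSide hv).mono
        (Set.subset_union_left (t := {e, G.rev e}))
      have h5 := (hT.reachable_tail_of_notMem_farSide h1).mono
        (Set.subset_union_left (t := {e, G.rev e}))
      exact ((h3 _ h2).trans (hstep.symm hR)).trans ((h5.symm hR).trans h4)
  · have hdisj : Disjoint (T \ {a, G.rev a}) {e, G.rev e} := by
      rw [Set.disjoint_left]
      rintro d ⟨hd, -⟩ (rfl | h)
      · exact he hd
      · rw [Set.mem_singleton_iff] at h
        exact he ((hT.revClosed.iff e).1 (h ▸ hd))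
    have hsub : {a, G.rev a} ⊆ T := by
      rintro d (rfl | rfl)
      · exact ha
      · exact hT.rev_mem _ ha
    rw [Set.ncard_union_eq hdisj, Set.ncard_sdiff hsub, Set.ncard_pair (G.rev_ne a).symm,
      Set.ncard_pair (G.rev_ne e).symm, ← hT.ncard_add_two hs]
    have := Set.ncard_le_ncard hsub
    rw [Set.ncard_pair (G.rev_ne a).symm] at this
    omega

end HeadSum

/-! ### Euler's formula and dual spanning trees -/

section Planar

variable {V D : Type*} [Fintype V] [Fintype D] {G : RibbonGraph V D}

omit [Fintype V] [Fintype D] in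
lemma leftFace_surjective : Function.Surjective G.dual.tail := Quotient.mk_surjective

omit [Fintype V] [Fintype D] in
variable (G) in
/-- The vertices of `G` are the faces of its dual. -/
lemma card_dual_face (hs : Function.Surjective G.tail) : Nat.card G.dual.Face = Nat.card V := by
  have hdd : G.dual.dualNext = G.next := by
    ext d
    exact G.rev_rev _
  refine Nat.card_congr (Equiv.ofBijective (Quotient.lift G.tail fun a b h => ?_) ⟨?_, ?_⟩)
  · have h : G.dual.dualNext.SameCycle a b := h
    rw [hdd] at h
    exact (G.sameCycle_iff a b).1 h
  · intro x y
    induction x using Quotient.inductionOn with | _ a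
    induction y using Quotient.inductionOn with | _ b
    intro h
    refine Quotient.sound ?_
    show G.dual.dualNext.SameCycle a b
    rw [hdd]
    exact (G.sameCycle_iff a b).2 h
  · intro v
    obtain ⟨d, rfl⟩ := hs v
    exact ⟨Quotient.mk _ d, rfl⟩

omit [Fintype V] [Fintype D] in
lemma Planar.dual (hs : Function.Surjective G.tail) (hG : G.Planar) : G.dual.Planar := by
  have : G.eulerChar = 2 := hG
  show G.dual.eulerChar = 2
  unfold eulerChar at *
  rw [G.card_dual_face hs]
  linarith

omit [Fintype V] in
lemma Connected.exists_isSpanningTree (hG : G.Connected) : ∃ T, G.IsSpanningTree T := by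
  obtain ⟨T, -, hT⟩ := ConnectedOn.exists_isSpanningTree (G := G) (A := Set.univ)
    (fun _ _ => trivial) hG
  exact ⟨T, hT⟩

omit [Fintype V] in
lemma two_dvd_card [Nonempty D] (hG : G.Connected) : 2 ∣ Fintype.card D := by
  obtain ⟨T, hT⟩ := hG.exists_isSpanningTree
  exact (hT.isOrientation_tourOrientation (Classical.arbitrary D)).two_dvd_card

lemma Planar.card_dart [Nonempty D] (hG : G.Connected) (hp : G.Planar) :
    Fintype.card D + 4 = 2 * Fintype.card V + 2 * Fintype.card G.Face := by
  have h1 := two_dvd_card hG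
  have h2 : G.eulerChar = 2 := hp
  unfold eulerChar at h2
  simp only [Nat.card_eq_fintype_card] at h2
  omega

/-- Transitivity of the tour passes to the dual and gives connectedness; Euler's formula gives the
right number of edges. -/
lemma IsSpanningTree.dual [Nonempty D] (hG : G.Connected) (hp : G.Planar) {T : Set D}
    (hT : G.IsSpanningTree T) : G.dual.IsSpanningTree Tᶜ := by
  have hR : G.dual.RevClosed Tᶜ := hT.revClosed.compl
  refine ConnectedOn.isSpanningTree_of_ncard hR ?_ leftFace_surjective ?_
  · exact TourTransitive.connectedOn hR ((dual_tourTransitive_iff hT.revClosed).2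
      hT.tourTransitive) leftFace_surjective
  · have h1 := hT.ncard_add_two (tail_surjective hG)
    have h2 := hp.card_dart hG
    have h3 := Set.ncard_add_ncard_compl T
    rw [Nat.card_eq_fintype_card] at h3
    omega

lemma IsSpanningTree.of_dual [Nonempty D] (hG : G.Connected) (hp : G.Planar) {T : Set D}
    (hT : G.dual.IsSpanningTree Tᶜ) : G.IsSpanningTree T := by
  have hR : G.RevClosed T := by
    simpa using RevClosed.compl (G := G) (A := Tᶜ) hT.rev_mem
  have hs := tail_surjective hG
  refine ConnectedOn.isSpanningTree_of_ncard hR ?_ hs ?_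
  · exact TourTransitive.connectedOn hR ((dual_tourTransitive_iff hR).1 hT.tourTransitive) hs
  · have h1 := hT.ncard_add_two leftFace_surjective
    have h2 := hp.card_dart hG
    have h3 := Set.ncard_add_ncard_compl T
    rw [Nat.card_eq_fintype_card] at h3
    omega

lemma Connected.dual [Nonempty D] (hG : G.Connected) (hp : G.Planar) : G.dual.Connected := by
  obtain ⟨T, hT⟩ := hG.exists_isSpanningTree
  have := (hT.dual hG hp).connected
  exact ⟨this.1, fun u v => (this.2 u v).mono (Set.subset_univ _)⟩

end Planar

/-! ### Injectivity of the Bernardi map -/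

section Injective

variable {V D : Type*} [Fintype V] [Fintype D] {G : RibbonGraph V D}

omit [Fintype V] [Fintype D] in
variable (G) in
/-- The cut between the complement of `X` and `X`. -/
lemma coboundary_indicator (X : Set V) (d : D) [Decidable (G.head d ∈ X)]
    [Decidable (G.tail d ∈ X)] : (G.coboundary (X.indicator 1)).1 d =
      (if G.head d ∈ X then 1 else 0) - (if G.tail d ∈ X then 1 else 0) := by
  classical
  rw [coboundary_apply, Set.indicator_apply, Set.indicator_apply]
  congr

/-- A flow that is nonnegative on a cut vanishes on it. -/
lemma eq_zero_of_nonneg_on_cut {c : G.chains} (hc : G.boundary c = 0) {X : Set V}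
    (h : ∀ d, G.tail d ∉ X → G.head d ∈ X → 0 ≤ c.1 d) {d : D} (h1 : G.tail d ∉ X)
    (h2 : G.head d ∈ X) : c.1 d = 0 := by
  classical
  have hsum := sum_coboundary_mul (X.indicator 1) c
  simp only [hc, Pi.zero_apply, mul_zero, Finset.sum_const_zero] at hsum
  -- The flow through the cut has total zero; a dart leaving X contributes the same as its reversal,
  -- which enters X.
  have hnn : ∀ b ∈ Finset.univ, 0 ≤
      (X.indicator 1 (G.head b) - X.indicator 1 (G.tail b)) * c.1 b := by
    intro b _
    by_cases hb1 : G.tail b ∈ X <;> by_cases hb2 : G.head b ∈ X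
    · simp [hb1, hb2]
    · have := h (G.rev b) (by simpa using hb2) (by simpa using hb1)
      rw [chains_apply_rev] at this
      simp [hb1, hb2]
      linarith
    · simpa [hb1, hb2] using h b hb1 hb2
    · simp [hb1, hb2]
  have := (Finset.sum_eq_zero_iff_of_nonneg hnn).1 hsum d (Finset.mem_univ d)
  simpa [h1, h2] using this

variable (G) in
/-- All vertices can be reached from `s` along the orientation `o`. -/
def ReachesAll (o : D → ℤ) (s : V) : Prop := ∀ v, G.Reachable {d | o d = 1} s v

/-- No positive dart of `o'` enters the set X not reached by it. The flow `o - o'` is then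
nonnegative, hence zero, on this cut, while some positive dart of `o` enters X. -/
lemma ReachesAll.of_headSum_eq {o o' : D → ℤ} (ho : G.IsOrientation o) (ho' : G.IsOrientation o')
    {s : V} (h : G.ReachesAll o s) (heq : G.headSum o' = G.headSum o) : G.ReachesAll o' s := by
  intro v
  by_contra hv
  set X : Set V := {w | ¬ G.Reachable {d | o' d = 1} s w}
  have hent : ∀ d, G.tail d ∉ X → G.head d ∈ X → o' d = 0 := by
    intro d h1 h2
    refine (ho' d).1.resolve_right fun h3 => h2 ?_
    exact Reachable.trans (not_not.1 h1) (.single h3)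
  obtain ⟨d, hd, h1, h2⟩ := (h v).exists_entering (X := X) (fun h => h (.refl _)) hv
  have := eq_zero_of_nonneg_on_cut (c := ho.diff ho') (X := X)
    (by rw [IsOrientation.boundary_diff, heq, sub_self])
    (fun b hb1 hb2 => by
      rw [IsOrientation.diff_apply, hent b hb1 hb2]
      simpa using ho.nonneg b) h1 h2
  rw [IsOrientation.diff_apply, hent d h1 h2, show o d = 1 from hd] at this
  omega

omit [Fintype V] in
lemma IsSpanningTree.reachesAll {T : Set D} (hT : G.IsSpanningTree T)
    (hs : Function.Surjective G.tail) (d₀ : D) :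
    G.ReachesAll (G.tourOrientation d₀ T) (G.tail d₀) := by
  intro v
  obtain ⟨d, rfl⟩ := hs v
  rw [← hT.iterate_tourTime d₀ d]
  generalize G.tourTime T d₀ d = n
  induction n using Nat.strong_induction_on with
  | _ n ih =>
    cases n with
    | zero => exact .refl _
    | succ n =>
      rw [Function.iterate_succ_apply']
      set b := (G.tourStep T)^[n] d₀ with hb
      have hbn : G.tourTime T d₀ b ≤ n := tourTime_le rfl
      by_cases hbT : b ∈ T
      · rw [tail_tourStep_of_mem hbT]
        by_cases hlt : G.tourTime T d₀ b < G.tourTime T d₀ (G.rev b)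
        · exact (ih n (by omega)).trans
            (.single ((tourOrientation_eq_one_iff_of_mem hbT).2 hlt))
        -- On a second passage the endpoint was already visited when the tour considered `rev b`.
        · have := ih (G.tourTime T d₀ (G.rev b)) (by omega)
          rwa [hT.iterate_tourTime] at this
      · rw [tail_tourStep_of_notMem hbT]
        exact ih n (by omega)

/-- Orientations in which everything can be reached from `s` and that have linearly equivalent
indegree functions have the same indegree function. -/
lemma ReachesAll.headSum_eq {o o' : D → ℤ} (ho : G.IsOrientation o) (ho' : G.IsOrientation o')
    {s : V} (h : G.ReachesAll o s) (h' : G.ReachesAll o' s) {f : V → ℤ}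
    (hf : G.headSum o - G.headSum o' = G.laplacian f) : G.headSum o = G.headSum o' := by
  -- With df the coboundary of f, both df and `o - o'` have boundary `laplacian f`, so their
  -- difference is a flow and is orthogonal to the cut df. Since df is integral and `o - o'` lies in
  -- [-1, 1], every term is nonnegative, hence zero. Thus f cannot decrease along `o` nor increase
  -- along `o'`, and reachability makes it constant.
  have hsum : ∑ d, (f (G.head d) - f (G.tail d)) *
      ((f (G.head d) - f (G.tail d)) - (o d - o' d)) = 0 := by
    have h1 := sum_coboundary_mul f (ho.diff ho')
    have h2 := sum_coboundary_mul f (G.coboundary f)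
    rw [IsOrientation.boundary_diff, hf, ← boundary_coboundary, ← h2] at h1
    simp only [mul_sub, Finset.sum_sub_distrib]
    simp only [IsOrientation.diff_apply, coboundary_apply, mul_sub, Finset.sum_sub_distrib] at h1
    linarith
  have hbd : ∀ d, -1 ≤ o d - o' d ∧ o d - o' d ≤ 1 := fun d =>
    ⟨by linarith [ho.nonneg d, ho'.le_one d], by linarith [ho.le_one d, ho'.nonneg d]⟩
  have hnn : ∀ d ∈ Finset.univ, 0 ≤ (f (G.head d) - f (G.tail d)) *
      ((f (G.head d) - f (G.tail d)) - (o d - o' d)) := by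
    intro d _
    have := hbd d
    rcases lt_trichotomy (f (G.head d) - f (G.tail d)) 0 with h | h | h
    · exact mul_nonneg_of_nonpos_of_nonpos h.le (by linarith)
    · simp [h]
    · exact mul_nonneg h.le (by linarith)
  have hz : ∀ d, f (G.head d) - f (G.tail d) = 0 ∨
      f (G.head d) - f (G.tail d) = o d - o' d := by
    intro d
    have := (Finset.sum_eq_zero_iff_of_nonneg hnn).1 hsum d (Finset.mem_univ d)
    rcases mul_eq_zero.1 this with h | h
    · exact .inl h
    · exact .inr (by linarith)
  have hge : ∀ v, f s ≤ f v := by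
    intro v
    induction h v with
    | refl => exact le_rfl
    | tail _ hd ih =>
      obtain ⟨d, hd, rfl, rfl⟩ := hd
      have hd : o d = 1 := hd
      have := hz d
      have := ho'.le_one d
      omega
  have hle : ∀ v, f v ≤ f s := by
    intro v
    induction h' v with
    | refl => exact le_rfl
    | tail _ hd ih =>
      obtain ⟨d, hd, rfl, rfl⟩ := hd
      have hd : o' d = 1 := hd
      have := hz d
      have := ho.le_one d
      omega
  have hc : G.coboundary f = 0 := by
    ext d
    show (G.coboundary f).1 d = 0
    rw [coboundary_apply, (hle _).antisymm (hge (G.head d)), (hle _).antisymm (hge (G.tail d)),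
      sub_self]
  rw [← boundary_coboundary, hc, map_zero] at hf
  exact sub_eq_zero.1 hf

omit [Fintype V] in
/-- An edge outside the tree that crosses the fundamental cut of a tree edge is oriented towards
the far side, unless it is met before the tour first reaches that tree edge. -/
lemma IsSpanningTree.tourTime_rev_lt_of_entering {T : Set D} (hT : G.IsSpanningTree T) {d₀ a e : D}
    (ha : a ∈ T) (hlt : G.tourTime T d₀ a < G.tourTime T d₀ (G.rev a))
    (h1 : G.tail e ∉ G.farSide T a) (h2 : G.head e ∈ G.farSide T a)
    (he : G.tourTime T d₀ a < G.tourTime T d₀ e) :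
    G.tourTime T d₀ (G.rev e) < G.tourTime T d₀ e := by
  have h0 := (hT.tourTime_lt_rev_iff ha).1 hlt
  have h3 := (hT.tourTime_farSide (d := e) ha h0).not.1 h1
  have h4 := (hT.tourTime_farSide (d := G.rev e) ha h0).1 h2
  omega

/-- Two spanning trees whose orientations have the same indegrees do not differ first at an edge
of the first one. -/
lemma IsSpanningTree.mem_of_headSum_eq {T T' : Set D} (hT : G.IsSpanningTree T)
    (hT' : G.IsSpanningTree T') {d₀ : D}
    (heq : G.headSum (G.tourOrientation d₀ T) = G.headSum (G.tourOrientation d₀ T')) {a : D}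
    (hag : ∀ b, G.tourTime T d₀ b < G.tourTime T d₀ a → (b ∈ T ↔ b ∈ T')) (ha : a ∈ T) :
    a ∈ T' := by
  by_contra ha'
  have hlt : G.tourTime T d₀ a < G.tourTime T d₀ (G.rev a) := by
    by_contra! h
    have := (hag (G.rev a) (lt_of_le_of_ne h (hT.tourTime_ne_rev d₀ a).symm)).1 (hT.rev_mem a ha)
    exact ha' ((hT'.revClosed.iff a).1 this)
  have ho := hT.isOrientation_tourOrientation d₀
  have ho' := hT'.isOrientation_tourOrientation d₀
  have hOa : G.tourOrientation d₀ T a = 1 := (tourOrientation_eq_one_iff_of_mem ha).2 hlt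
  have hOa' : G.tourOrientation d₀ T' a = 0 := by
    refine (ho' a).1.resolve_right fun h => ?_
    rw [hT'.tourOrientation_eq_one_iff_of_notMem ha'] at h
    have e1 := (tourTime_congr hT hT' hag le_rfl a).2 rfl
    rw [e1, tourTime_lt_congr hT hT' hag (by omega)] at h
    omega
  have h0 := (hT.tourTime_lt_rev_iff ha).1 hlt
  -- On the fundamental cut of `a`, edges met before `a` are oriented alike by both trees, those met
  -- later point to the far side in the orientation of T, and `a` itself contributes 1.
  have := eq_zero_of_nonneg_on_cut (c := ho.diff ho') (X := G.farSide T a)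
    (by rw [IsOrientation.boundary_diff, heq, sub_self])
    (fun b hb1 hb2 => by
      rw [IsOrientation.diff_apply]
      by_cases hbT : b ∈ T
      · rw [hT.eq_of_entering ha hbT hb1 hb2, hOa, hOa']
        norm_num
      · rcases lt_trichotomy (G.tourTime T d₀ b) (G.tourTime T d₀ a) with h | h | h
        · rw [tourOrientation_congr hT hT' hag (.inl h), sub_self]
        · exact absurd (hT.tourTime_inj.1 h ▸ ha) hbT
        · rw [(hT.tourOrientation_eq_one_iff_of_notMem hbT).2
            (hT.tourTime_rev_lt_of_entering ha hlt hb1 hb2 h)]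
          linarith [ho'.le_one b])
    (hT.tail_notMem_farSide ha) (head_mem_farSide T a)
  rw [IsOrientation.diff_apply, hOa, hOa'] at this
  omega

lemma IsSpanningTree.eq_of_headSum_eq {T T' : Set D} (hT : G.IsSpanningTree T)
    (hT' : G.IsSpanningTree T') {d₀ : D}
    (heq : G.headSum (G.tourOrientation d₀ T) = G.headSum (G.tourOrientation d₀ T')) :
    T = T' := by
  have key : ∀ n b, G.tourTime T d₀ b = n → (b ∈ T ↔ b ∈ T') := by
    intro n
    induction n using Nat.strong_induction_on with
    | _ n ih =>
      rintro b rfl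
      have hag : ∀ c, G.tourTime T d₀ c < G.tourTime T d₀ b → (c ∈ T ↔ c ∈ T') :=
        fun c hc => ih _ hc c rfl
      refine ⟨hT.mem_of_headSum_eq hT' heq hag, hT'.mem_of_headSum_eq hT heq.symm ?_⟩
      intro c hc
      rw [(tourTime_congr hT hT' hag le_rfl b).2 rfl, tourTime_lt_congr hT hT' hag (by omega)] at hc
      exact (hag c hc).symm
  exact Set.ext fun b => key _ b rfl

omit [Fintype V] in
lemma divClass_eq_iff {x y : V → ℤ} :
    G.divClass x = G.divClass y ↔ ∃ f, y - x = G.laplacian f := by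
  show (QuotientAddGroup.mk x : G.Pic) = QuotientAddGroup.mk y ↔ _
  rw [QuotientAddGroup.eq, neg_add_eq_sub]
  exact ⟨fun ⟨f, hf⟩ => ⟨f, hf.symm⟩, fun ⟨f, hf⟩ => ⟨f, hf.symm⟩⟩

theorem bernardiClass_injective (hs : Function.Surjective G.tail) (d₀ : D) :
    Function.Injective (G.bernardiClass d₀) := by
  rintro ⟨T, hT⟩ ⟨T', hT'⟩ h
  obtain ⟨f, hf⟩ := divClass_eq_iff.1 h.symm
  have h1 := hT.bernardiDivisor_add hs d₀
  have h2 := hT'.bernardiDivisor_add hs d₀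
  have h3 : G.headSum (G.tourOrientation d₀ T) - G.headSum (G.tourOrientation d₀ T') =
      G.laplacian f := by
    rw [← h1, ← h2, ← hf]
    exact add_sub_add_right_eq_sub _ _ _
  refine Subtype.ext (hT.eq_of_headSum_eq hT' (d₀ := d₀) ?_)
  exact (hT.reachesAll hs d₀).headSum_eq (hT.isOrientation_tourOrientation d₀)
    (hT'.isOrientation_tourOrientation d₀) (hT'.reachesAll hs d₀) h3

end Injective

/-! ### Degree zero classes as chains modulo flows and cuts -/

section Degree

variable {V D : Type*} [Fintype V] [Fintype D] {G : RibbonGraph V D}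

omit [Fintype D] in
/-- Functions with sum zero are generated by differences of two points. -/
lemma mem_of_sum_eq_zero [DecidableEq V] {M : AddSubmonoid (V → ℤ)}
    (h : ∀ u v : V, Pi.single u 1 - Pi.single v 1 ∈ M) {x : V → ℤ} (hx : ∑ v, x v = 0) : x ∈ M := by
  rcases isEmpty_or_nonempty V with hV | ⟨⟨q⟩⟩
  · rw [Subsingleton.elim x 0]
    exact M.zero_mem
  have hx' : x = ∑ v, x v • (Pi.single v 1 - Pi.single q 1 : V → ℤ) := by
    simp only [smul_sub, Finset.sum_sub_distrib]
    rw [← Finset.sum_smul, hx, zero_smul, sub_zero]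
    funext v
    simp [Finset.sum_apply, Pi.single_apply]
  rw [hx']
  refine M.sum_mem fun v _ => ?_
  obtain ⟨n, hn | hn⟩ := (x v).eq_nat_or_neg
  · rw [hn, natCast_zsmul]
    exact M.nsmul_mem (h v q) n
  · rw [hn, neg_smul, ← smul_neg, neg_sub, natCast_zsmul]
    exact M.nsmul_mem (h q v) n

variable (G) in
open Classical in
/-- The chain of a single oriented edge. -/
noncomputable def edgeChain (d : D) : G.chains :=
  ⟨Pi.single d 1 - Pi.single (G.rev d) 1, fun b => by
    simp only [Pi.sub_apply, Pi.single_apply, G.rev_eq_iff, rev_rev']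
    ring⟩

omit [Fintype V] [Fintype D] in
open Classical in
lemma edgeChain_apply (d b : D) :
    (G.edgeChain d).1 b = (if b = d then 1 else 0) - (if b = G.rev d then 1 else 0) := by
  simp [edgeChain, Pi.single_apply]

omit [Fintype V] in
lemma headSum_single [DecidableEq D] [DecidableEq V] (d : D) :
    G.headSum (Pi.single d 1) = Pi.single (G.head d) 1 := by
  funext v
  simp only [headSum, Pi.single_apply, Finset.sum_filter]
  rw [Finset.sum_eq_single d]
  · simp [eq_comm]
  · intro b _ hb
    simp [hb]
  · simp

omit [Fintype V] in
lemma boundary_edgeChain [DecidableEq V] (d : D) :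
    G.boundary (G.edgeChain d) = Pi.single (G.head d) 1 - Pi.single (G.tail d) 1 := by
  classical
  rw [boundary_eq_headSum, edgeChain, headSum_sub, headSum_single, headSum_single, head_rev]

lemma range_boundary (hG : G.Connected) : G.boundary.range = div0 := by
  classical
  ext x
  constructor
  · rintro ⟨c, rfl⟩
    exact sum_boundary c
  · intro hx
    refine mem_of_sum_eq_zero (M := G.boundary.range.toAddSubmonoid) (fun u v => ?_) hx
    show Pi.single u 1 - Pi.single v 1 ∈ G.boundary.range
    induction hG.2 v u with
    | refl => simp
    | tail _ h ih =>
      obtain ⟨d, -, rfl, rfl⟩ := h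
      have := G.boundary.range.add_mem ⟨G.edgeChain d, boundary_edgeChain d⟩ ih
      rwa [sub_add_sub_cancel] at this

lemma divClass_boundary_mem_pic0 (c : G.chains) : G.divClass (G.boundary c) ∈ G.pic0 :=
  ⟨_, sum_boundary c, rfl⟩

variable (G) in
/-- The homomorphism from chains to degree zero divisor classes induced by the boundary. -/
noncomputable def boundaryClass : G.chains →+ G.pic0 :=
  (G.divClass.comp G.boundary).codRestrict G.pic0 divClass_boundary_mem_pic0

lemma coe_boundaryClass (c : G.chains) :
    (G.boundaryClass c : G.Pic) = G.divClass (G.boundary c) := rfl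

lemma boundaryClass_surjective (hG : G.Connected) : Function.Surjective G.boundaryClass := by
  rintro ⟨_, x, hx, rfl⟩
  have hx : x ∈ G.boundary.range := by rwa [range_boundary hG]
  obtain ⟨c, rfl⟩ := hx
  exact ⟨c, rfl⟩

lemma ker_boundaryClass : G.boundaryClass.ker = G.flows ⊔ G.cuts := by
  ext c
  have h1 : c ∈ G.boundaryClass.ker ↔ G.boundary c ∈ G.prin := by
    rw [AddMonoidHom.mem_ker, ← Subtype.coe_inj, coe_boundaryClass]
    exact QuotientAddGroup.eq_zero_iff _
  rw [h1, AddSubgroup.mem_sup]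
  constructor
  · rintro ⟨f, hf⟩
    -- The boundary of a coboundary is the Laplacian, so subtracting the cut of f leaves a flow.
    refine ⟨c - G.coboundary f, ?_, G.coboundary f, ⟨f, rfl⟩, by simp⟩
    rw [mem_flows, map_sub, boundary_coboundary, hf, sub_self]
  · rintro ⟨z, hz, _, ⟨f, rfl⟩, rfl⟩
    rw [map_add, mem_flows.1 hz, zero_add, boundary_coboundary]
    exact ⟨f, rfl⟩

variable (G) in
/-- The isomorphism from chains modulo flows and cuts to degree zero divisor classes. -/
noncomputable def chainQuotEquiv (hG : G.Connected) : G.ChainQuot ≃+ G.pic0 :=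
  (QuotientAddGroup.quotientAddEquivOfEq ker_boundaryClass.symm).trans
    (QuotientAddGroup.quotientKerEquivOfSurjective G.boundaryClass (boundaryClass_surjective hG))

lemma chainQuotEquiv_mk (hG : G.Connected) (c : G.chains) :
    (G.chainQuotEquiv hG (QuotientAddGroup.mk c) : G.Pic) = G.divClass (G.boundary c) := rfl

end Degree

/-! ### Chains on a spanning tree -/

section TreeChains

variable {V D : Type*} [Fintype D] {G : RibbonGraph V D} {T : Set D}

/-- A flow supported on a spanning tree vanishes. -/
lemma IsSpanningTree.eq_zero_of_boundary_eq_zero [Fintype V] (hT : G.IsSpanningTree T)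
    {c : G.chains} (hc : G.boundary c = 0) (h : ∀ d ∉ T, c.1 d = 0) : c = 0 := by
  have key : ∀ a ∈ T, 0 ≤ c.1 a → c.1 a = 0 := by
    intro a ha hnn
    refine eq_zero_of_nonneg_on_cut hc (X := G.farSide T a) (fun b hb1 hb2 => ?_)
      (hT.tail_notMem_farSide ha) (head_mem_farSide T a)
    by_cases hb : b ∈ T
    · rwa [hT.eq_of_entering ha hb hb1 hb2]
    · rw [h b hb]
  ext d
  show c.1 d = 0
  by_cases hd : d ∈ T
  · rcases le_total 0 (c.1 d) with h0 | h0
    · exact key d hd h0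
    · have := key (G.rev d) (hT.rev_mem d hd) (by rw [chains_apply_rev]; linarith)
      rw [chains_apply_rev] at this
      linarith
  · exact h d hd

/-- On a spanning tree every chain is a coboundary. -/
lemma IsSpanningTree.exists_coboundary_eq [Nonempty D] (hT : G.IsSpanningTree T) (c : G.chains) :
    ∃ f, ∀ d ∈ T, (G.coboundary f).1 d = c.1 d := by
  classical
  have ho := hT.isOrientation_tourOrientation (Classical.arbitrary D)
  set o := G.tourOrientation (Classical.arbitrary D) T
  -- The fundamental cut of `a` meets T only in its own edge. The orientation factor `o a` selects
  -- one dart per edge, so that each edge is counted once.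
  refine ⟨∑ a ∈ Finset.univ.filter (· ∈ T), (o a * c.1 a) • (G.farSide T a).indicator 1,
    fun b hb => ?_⟩
  have hval : ∀ a ∈ T, (G.coboundary ((G.farSide T a).indicator 1)).1 b =
      (if a = b then 1 else 0) - (if a = G.rev b then 1 else 0) := by
    intro a ha
    rw [coboundary_indicator]
    have hne := G.rev_ne b
    by_cases h1 : b = a
    · subst h1
      simp [hT.tail_notMem_farSide hb, head_mem_farSide, hne.symm]
    by_cases h2 : a = G.rev b
    · subst h2
      have h3 := hT.tail_notMem_farSide ha
      have h4 := head_mem_farSide (G := G) T (G.rev b)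
      rw [tail_rev] at h3
      rw [head_rev] at h4
      simp [h3, h4, hne]
    · rw [hT.farSide_iff hb h1 (fun h => h2 (by rw [h, rev_rev'])), sub_self, if_neg (Ne.symm h1),
        if_neg h2, sub_self]
  have hsum : (G.coboundary (∑ a ∈ Finset.univ.filter (· ∈ T),
      (o a * c.1 a) • (G.farSide T a).indicator 1)).1 b =
      ∑ a ∈ Finset.univ.filter (· ∈ T), (o a * c.1 a) *
        (G.coboundary ((G.farSide T a).indicator 1)).1 b := by
    simp only [coboundary_apply, Finset.sum_apply, Pi.smul_apply, smul_eq_mul, mul_sub,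
      Finset.sum_sub_distrib]
  rw [hsum, Finset.sum_congr rfl fun a ha => by rw [hval a (by simpa using ha)]]
  simp only [mul_sub, Finset.sum_sub_distrib, mul_ite, mul_one, mul_zero, Finset.sum_ite_eq',
    Finset.mem_filter, Finset.mem_univ, true_and, hb, hT.rev_mem b hb, if_true]
  rw [chains_apply_rev, ho.rev_eq]
  ring

end TreeChains

/-! ### Flows and cuts under planar duality -/

section DualChains

variable {V D : Type*} [Fintype D] {G : RibbonGraph V D}

omit [Fintype D] in
lemma leftFace_rev_next (d : D) : G.dual.tail (G.rev (G.next d)) = G.dual.tail d :=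
  tail_next G.dual d

variable (G) in
/-- The identification of chains of `G` with chains of its dual, as an isomorphism. -/
def dualChainEquiv : G.chains ≃+ G.dual.chains where
  toFun := G.dualChain
  invFun c := ⟨c.1, c.2⟩
  left_inv _ := rfl
  right_inv _ := rfl
  map_add' _ _ := rfl

omit [Fintype D] in
lemma dualChainEquiv_apply (c : G.chains) : G.dualChainEquiv c = G.dualChain c := rfl

omit [Fintype D] in
lemma dualChainEquiv_symm_apply (c : G.dual.chains) (d : D) :
    (G.dualChainEquiv.symm c).1 d = c.1 d := rfl

lemma headSum_eq_sum_tail [DecidableEq V] (c : D → ℤ) (v : V) :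
    G.headSum c v = ∑ d with G.tail d = v, c (G.rev d) := by
  rw [headSum, Finset.sum_filter, Finset.sum_filter,
    ← Equiv.sum_comp G.revPerm]
  refine Finset.sum_congr rfl fun d _ => ?_
  rw [show G.revPerm d = G.rev d from rfl, head_rev]
  by_cases h : G.tail d = v <;> simp [h]

lemma sum_tail_next {V : Type*} [DecidableEq V] (G : RibbonGraph V D) (F : D → ℤ) (v : V) :
    ∑ d with G.tail d = v, F (G.next d) = ∑ d with G.tail d = v, F d := by
  rw [Finset.sum_filter, Finset.sum_filter,
    ← Equiv.sum_comp G.next (fun d => if G.tail d = v then F d else 0)]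
  exact Finset.sum_congr rfl fun d _ => if_congr (by rw [tail_next]) rfl rfl

/-- The boundary of a face is a flow. -/
lemma boundary_dual_coboundary (F : G.Face → ℤ) :
    G.boundary (G.dualChainEquiv.symm (G.dual.coboundary F)) = 0 := by
  classical
  funext v
  rw [boundary_eq_headSum, headSum_eq_sum_tail]
  simp only [dualChainEquiv_symm_apply, coboundary_apply]
  have h : ∀ d, F (G.dual.head (G.rev d)) - F (G.dual.tail (G.rev d)) =
      F (G.dual.tail d) - F (G.dual.tail (G.rev d)) := by
    intro d
    rw [show G.dual.head (G.rev d) = G.dual.tail d from head_rev G.dual d]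
  simp only [h, Finset.sum_sub_distrib]
  -- Consecutive darts at a vertex bound a common face, so the sum cancels after one rotation.
  rw [← sum_tail_next G fun d => F (G.dual.tail (G.rev d))]
  simp only [leftFace_rev_next, sub_self]
  rfl

/-- A cut of `G` is a flow of the dual. -/
lemma dual_boundary_coboundary (f : V → ℤ) :
    G.dual.boundary (G.dualChain (G.coboundary f)) = 0 := by
  classical
  funext φ
  rw [boundary_eq_headSum, headSum_eq_sum_tail]
  have h : ∀ d, (G.dualChain (G.coboundary f)).1 (G.dual.rev d) =
      f (G.tail d) - f (G.head d) := by
    intro d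
    show f (G.head (G.rev d)) - f (G.tail (G.rev d)) = _
    rw [head_rev, tail_rev]
  simp only [h, Finset.sum_sub_distrib]
  rw [← sum_tail_next G.dual fun d => f (G.head d)]
  have h2 : ∀ d, G.head (G.dual.next d) = G.tail d := fun d => by
    rw [dual_next, head_rev, tail_next]
  simp only [h2, sub_self]
  rfl

variable [Fintype V] [Nonempty D]

lemma mem_flows_iff_dual_mem_cuts (hG : G.Connected) (hp : G.Planar) (c : G.chains) :
    c ∈ G.flows ↔ G.dualChain c ∈ G.dual.cuts := by
  constructor
  · intro hc
    obtain ⟨T, hT⟩ := hG.exists_isSpanningTree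
    -- Match c by a dual cut on the dual tree; the discrepancy is a flow supported on T, hence zero.
    obtain ⟨F, hF⟩ := (hT.dual hG hp).exists_coboundary_eq (G.dualChain c)
    refine ⟨F, ?_⟩
    have := hT.eq_zero_of_boundary_eq_zero
      (c := G.dualChainEquiv.symm (G.dual.coboundary F) - c)
      (by rw [map_sub, boundary_dual_coboundary, mem_flows.1 hc, sub_zero])
      (fun d hd => sub_eq_zero.2 (hF d hd))
    rw [sub_eq_zero, AddEquiv.symm_apply_eq] at this
    exact this
  · rintro ⟨F, hF⟩
    have := boundary_dual_coboundary F
    rw [hF] at this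
    exact this

lemma dual_mem_flows_iff_mem_cuts (hG : G.Connected) (hp : G.Planar) (c : G.chains) :
    G.dualChain c ∈ G.dual.flows ↔ c ∈ G.cuts := by
  constructor
  · intro hc
    obtain ⟨T, hT⟩ := hG.exists_isSpanningTree
    obtain ⟨f, hf⟩ := hT.exists_coboundary_eq c
    refine ⟨f, ?_⟩
    have := (hT.dual hG hp).eq_zero_of_boundary_eq_zero
      (c := G.dualChainEquiv (G.coboundary f - c))
      (by
        rw [map_sub, map_sub, dualChainEquiv_apply, dual_boundary_coboundary,
          dualChainEquiv_apply, mem_flows.1 hc, sub_zero])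
      (fun d hd => sub_eq_zero.2 (hf d (not_not.1 hd)))
    rw [AddEquiv.map_eq_zero_iff, sub_eq_zero] at this
    exact this
  · rintro ⟨f, rfl⟩
    exact dual_boundary_coboundary f

lemma map_flows_sup_cuts (hG : G.Connected) (hp : G.Planar) :
    (G.flows ⊔ G.cuts).map (G.dualChainEquiv : G.chains →+ G.dual.chains) =
      G.dual.flows ⊔ G.dual.cuts := by
  have h1 : G.flows.map (G.dualChainEquiv : G.chains →+ G.dual.chains) = G.dual.cuts := by
    ext c
    refine (AddSubgroup.mem_map_equiv (f := G.dualChainEquiv)).trans ?_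
    rw [mem_flows_iff_dual_mem_cuts hG hp]
    rfl
  have h2 : G.cuts.map (G.dualChainEquiv : G.chains →+ G.dual.chains) = G.dual.flows := by
    ext c
    refine (AddSubgroup.mem_map_equiv (f := G.dualChainEquiv)).trans ?_
    rw [← dual_mem_flows_iff_mem_cuts hG hp]
    rfl
  rw [AddSubgroup.map_sup, h1, h2, sup_comm]

variable (G) in
/-- The identification of chains modulo flows and cuts of `G` and of its dual. -/
noncomputable def dualChainQuotEquiv (hG : G.Connected) (hp : G.Planar) : G.ChainQuot ≃+ G.dual.ChainQuot :=
  QuotientAddGroup.congr _ _ G.dualChainEquiv (map_flows_sup_cuts hG hp)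

lemma dualChainQuotEquiv_mk (hG : G.Connected) (hp : G.Planar) (c : G.chains) :
    G.dualChainQuotEquiv hG hp (QuotientAddGroup.mk c) = QuotientAddGroup.mk (G.dualChain c) := rfl

end DualChains

/-! ### Reversing cuts and paths of an orientation -/

section Reversal

variable {V D : Type*} [Fintype V] [Fintype D] {G : RibbonGraph V D}

omit [Fintype V] [Fintype D] in
/-- Reversing a cut all of whose edges leave `X`. -/
lemma IsOrientation.add_cut {o : D → ℤ} (ho : G.IsOrientation o) {X : Set V}
    (h : ∀ d, G.tail d ∉ X → G.head d ∈ X → o d = 0) :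
    G.IsOrientation (o + (G.coboundary (X.indicator 1)).1) := by
  classical
  intro d
  have h1 := h d
  have h2 := h (G.rev d)
  rw [ho.rev_eq, tail_rev, head_rev] at h2
  have h3 := ho d
  have h4 := chains_apply_rev (G.coboundary (X.indicator 1)) d
  simp only [Pi.add_apply, h4]
  refine ⟨?_, by linarith [h3.2]⟩
  rw [coboundary_indicator]
  by_cases ht : G.tail d ∈ X <;> by_cases hh : G.head d ∈ X
  · simpa [ht, hh] using h3.1
  · left; simp [ht, hh]; linarith [h2 hh ht]
  · right; simp [ht, hh, h1]
  · simpa [ht, hh] using h3.1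

omit [Fintype V] [Fintype D] in
/-- By reversing cuts, everything can be made reachable from `s`. -/
lemma IsOrientation.exists_reachesAll [Finite V] (hG : G.Connected) {o : D → ℤ}
    (ho : G.IsOrientation o) (s : V) : ∃ f : V → ℤ,
      G.IsOrientation (o + (G.coboundary f).1) ∧ G.ReachesAll (o + (G.coboundary f).1) s := by
  classical
  induction hn : {w | ¬ G.Reachable {d | o d = 1} s w}.ncard using Nat.strong_induction_on
    generalizing o with
  | _ n ih =>
    set X : Set V := {w | ¬ G.Reachable {d | o d = 1} s w} with hX
    by_cases hall : G.ReachesAll o s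
    · refine ⟨0, ?_⟩
      rw [map_zero]
      simpa using ⟨ho, hall⟩
    · obtain ⟨v, hv⟩ := not_forall.1 hall
      have hent : ∀ d, G.tail d ∉ X → G.head d ∈ X → o d = 0 := fun d h1 h2 =>
        (ho d).1.resolve_right fun h3 => h2 (Reachable.trans (not_not.1 h1) (.single h3))
      have ho' := ho.add_cut hent
      -- Every edge between X and its complement leaves X. Reversing them all keeps what was
      -- reachable and adds a vertex of X.
      set o' := o + (G.coboundary (X.indicator 1)).1 with ho'_def
      have hkeep : ∀ w, w ∉ X → G.Reachable {d | o' d = 1} s w := by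
        intro w hw
        have hw := not_not.1 hw
        induction hw with
        | refl => exact .refl _
        | @tail x y hx hd ihx =>
          obtain ⟨d, hd, rfl, rfl⟩ := hd
          have h1 : G.tail d ∉ X := not_not.2 hx
          have h2 : G.head d ∉ X := not_not.2 (Reachable.trans hx (.single hd))
          refine (ihx h1).trans (.single ?_)
          show o d + _ = 1
          rw [coboundary_indicator, if_neg h1, if_neg h2, show o d = 1 from hd]
          norm_num
      obtain ⟨d, -, h1, h2⟩ := (hG.2 s v).exists_entering (X := X) (fun h => h (.refl _)) hv
      have hnew : G.Reachable {d | o' d = 1} s (G.head d) := by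
        refine (hkeep _ h1).trans (.single ?_)
        show o d + _ = 1
        rw [coboundary_indicator, if_neg h1, if_pos h2, hent d h1 h2]
        norm_num
      have hlt : {w | ¬ G.Reachable {d | o' d = 1} s w}.ncard < n := by
        rw [← hn]
        refine Set.ncard_lt_ncard ⟨fun w hw => ?_, fun h => h h2 hnew⟩
        by_contra h
        exact hw (hkeep w h)
      obtain ⟨f, hf1, hf2⟩ := ih _ hlt ho' rfl
      refine ⟨X.indicator 1 + f, ?_⟩
      have : o + (G.coboundary (X.indicator 1 + f)).1 = o' + (G.coboundary f).1 := by
        rw [map_add, ho'_def, add_assoc]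
        rfl
      rw [this]
      exact ⟨hf1, hf2⟩

omit [Fintype V] [Fintype D] in
/-- Reversing one edge. -/
lemma IsOrientation.sub_edgeChain {o : D → ℤ} (ho : G.IsOrientation o) {d : D} (hd : o d = 1) :
    G.IsOrientation (o - (G.edgeChain d).1) := by
  intro b
  have h := ho b
  have hr := chains_apply_rev (G.edgeChain d) b
  simp only [Pi.sub_apply, hr]
  refine ⟨?_, by linarith [h.2]⟩
  rw [edgeChain_apply]
  have hne := G.rev_ne d
  by_cases h1 : b = d
  · subst h1; left; simp [hd, hne.symm]
  by_cases h2 : b = G.rev d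
  · subst h2; right; simp [ho.rev_eq, hd, hne]
  · simpa [h1, h2] using h.1

omit [Fintype V] in
/-- Reversing a directed path. -/
lemma IsOrientation.exists_reverse_path [DecidableEq V] {n : ℕ} {W : Finset V} (hW : W.card = n)
    {o : D → ℤ} (ho : G.IsOrientation o) {s t : V}
    (h : Relation.ReflTransGen
      (fun x y => y ∈ W ∧ ∃ d, o d = 1 ∧ G.tail d = x ∧ G.head d = y) s t) :
    ∃ o', G.IsOrientation o' ∧ G.headSum o' = G.headSum o + (Pi.single s 1 - Pi.single t 1) := by
  induction n generalizing W o t with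
  | zero =>
    rw [Finset.card_eq_zero] at hW
    rcases Relation.ReflTransGen.cases_tail h with rfl | ⟨_, -, h, -⟩
    · exact ⟨o, ho, by simp⟩
    · simp [hW] at h
  | succ n ih =>
    -- Cut the path at its first arrival at t. The part before it never enters t, so it avoids the
    -- last edge and survives its reversal; the set W of admissible vertices shrinks by t.
    have key : ∀ z, Relation.ReflTransGen
        (fun x y => y ∈ W ∧ ∃ d, o d = 1 ∧ G.tail d = x ∧ G.head d = y) s z →
        Relation.ReflTransGen
          (fun x y => y ∈ W.erase t ∧ ∃ d, o d = 1 ∧ G.tail d = x ∧ G.head d = y) s z ∨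
        ∃ y, Relation.ReflTransGen
          (fun x y => y ∈ W.erase t ∧ ∃ d, o d = 1 ∧ G.tail d = x ∧ G.head d = y) s y ∧
          t ∈ W ∧ ∃ d, o d = 1 ∧ G.tail d = y ∧ G.head d = t := by
      intro z hz
      induction hz with
      | refl => exact .inl .refl
      | @tail x y _ hd ih =>
        refine ih.elim (fun h' => ?_) .inr
        by_cases hy : y = t
        · subst hy; exact .inr ⟨x, h', hd⟩
        · exact .inl (h'.tail ⟨Finset.mem_erase.2 ⟨hy, hd.1⟩, hd.2⟩)
    rcases key t h with h' | ⟨y, h', htW, d, hd, rfl, rfl⟩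
    · rcases Relation.ReflTransGen.cases_tail h' with rfl | ⟨_, -, h, -⟩
      · exact ⟨o, ho, by simp⟩
      · simp at h
    · have ho₁ := ho.sub_edgeChain hd
      obtain ⟨o', ho', he⟩ := ih (W := W.erase (G.head d)) (t := G.tail d)
        (by rw [Finset.card_erase_of_mem htW, hW]; rfl) ho₁ (by
          refine Relation.ReflTransGen.mono (fun x y hxy => ⟨hxy.1, ?_⟩) _ _ h'
          obtain ⟨hy, b, hb, hbx, rfl⟩ := hxy
          refine ⟨b, ?_, hbx, rfl⟩
          have h1 : b ≠ d := by rintro rfl; simp at hy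
          have h2 : b ≠ G.rev d := by
            rintro rfl
            rw [ho.rev_eq, hd] at hb
            omega
          simp [edgeChain_apply, h1, h2, hb])
      refine ⟨o', ho', ?_⟩
      rw [he, headSum_sub, ← boundary_eq_headSum, boundary_edgeChain]
      abel

lemma exists_orientation_divClass_eq [Nonempty D] (hG : G.Connected) {o : D → ℤ}
    (ho : G.IsOrientation o) {x : V → ℤ} (hx : ∑ v, x v = 0) :
    ∃ o', G.IsOrientation o' ∧ G.divClass (G.headSum o') = G.divClass (G.headSum o + x) := by
  classical
  let M : AddSubmonoid (V → ℤ) :=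
    { carrier := {x | ∀ o, G.IsOrientation o → ∃ o', G.IsOrientation o' ∧
        G.divClass (G.headSum o') = G.divClass (G.headSum o + x)}
      zero_mem' := fun o ho => ⟨o, ho, by rw [add_zero]⟩
      add_mem' := fun {x y} hx hy o ho => by
        obtain ⟨o₁, ho₁, h₁⟩ := hx o ho
        obtain ⟨o₂, ho₂, h₂⟩ := hy o₁ ho₁
        refine ⟨o₂, ho₂, ?_⟩
        rw [h₂, map_add, h₁, ← map_add, add_assoc] }
  have hM : x ∈ M := by
    refine mem_of_sum_eq_zero (fun s t o ho => ?_) hx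
    obtain ⟨f, ho₁, hr⟩ := ho.exists_reachesAll hG s
    -- Cut reversals stay within the divisor class and create a directed path from s to t; reversing
    -- it moves one indegree from t to s.
    obtain ⟨o₂, ho₂, h₂⟩ := ho₁.exists_reverse_path (W := Finset.univ) (s := s) (t := t) rfl
      (Relation.ReflTransGen.mono (fun x y ⟨d, hd, h⟩ => ⟨Finset.mem_univ _, d, hd, h⟩) _ _ (hr t))
    refine ⟨o₂, ho₂, ?_⟩
    rw [h₂, headSum_add, ← boundary_eq_headSum, boundary_coboundary, divClass_eq_iff]
    refine ⟨-f, ?_⟩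
    rw [map_neg]
    abel
  exact hM o ho

/-- Every divisor class of the right degree is represented by the indegree function of an
orientation for which everything can be reached from `s`. -/
lemma exists_reachesAll_divClass_eq [Nonempty D] (hG : G.Connected) (s : V) {x : V → ℤ}
    (hx : 2 * ∑ v, x v = Fintype.card D) : ∃ o, G.IsOrientation o ∧ G.ReachesAll o s ∧
      G.divClass (G.headSum o) = G.divClass x := by
  obtain ⟨T, hT⟩ := hG.exists_isSpanningTree
  have ho := hT.isOrientation_tourOrientation (Classical.arbitrary D)
  obtain ⟨o₁, ho₁, h₁⟩ := exists_orientation_divClass_eq hG ho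
    (x := x - G.headSum (G.tourOrientation (Classical.arbitrary D) T)) (by
      have := ho.two_mul_sum
      simp only [Pi.sub_apply, Finset.sum_sub_distrib, sum_headSum]
      omega)
  obtain ⟨f, ho₂, hr⟩ := ho₁.exists_reachesAll hG s
  refine ⟨_, ho₂, hr, ?_⟩
  rw [add_sub_cancel] at h₁
  rw [← h₁, headSum_add, ← boundary_eq_headSum, boundary_coboundary, divClass_eq_iff]
  refine ⟨-f, ?_⟩
  rw [map_neg]
  abel

end Reversal

/-! ### Surjectivity: the greedy construction of a tree -/

section Surjective

variable {V D : Type*} [Fintype V] [Fintype D] {G : RibbonGraph V D}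

omit [Fintype V] in
lemma IsSpanningTree.tourTime_lt_card {T : Set D} (hT : G.IsSpanningTree T) (d₀ d : D) :
    G.tourTime T d₀ d < Fintype.card D := by
  have hinj : Function.Injective
      fun k : Fin (G.tourTime T d₀ d + 1) => (G.tourStep T)^[(k : ℕ)] d₀ := by
    intro k l h
    have h1 := hT.tourTime_iterate (d₀ := d₀) (d := d) (n := k) (by omega)
    have h2 := hT.tourTime_iterate (d₀ := d₀) (d := d) (n := l) (by omega)
    refine Fin.ext ?_
    rw [← h1, ← h2]
    exact congrArg _ h
  have := Fintype.card_le_of_injective _ hinj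
  rw [Fintype.card_fin] at this
  omega

/-- If an orientation first deviates from the one of a spanning tree at a tree edge, then either
this edge can be exchanged without affecting the tour before, or the orientation has a directed
fundamental cut. -/
lemma IsSpanningTree.exists_exchange_or_directed_cut [Nonempty D]
    (hs : Function.Surjective G.tail) {T : Set D} (hT : G.IsSpanningTree T) {d₀ a : D} (ha : a ∈ T)
    (hlt : G.tourTime T d₀ a < G.tourTime T d₀ (G.rev a)) {o : D → ℤ}
    (hag : ∀ b, G.tourTime T d₀ b < G.tourTime T d₀ a → o b = G.tourOrientation d₀ T b)
    (hoa : o a = 0) :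
    (∃ T', G.IsSpanningTree T' ∧ a ∉ T' ∧
      ∀ b, G.tourTime T d₀ b < G.tourTime T d₀ a → (b ∈ T ↔ b ∈ T')) ∨
    ∀ b, G.tail b ∉ G.farSide T a → G.head b ∈ G.farSide T a → o b = 0 := by
  have h0 := (hT.tourTime_lt_rev_iff ha).1 hlt
  -- If no such edge exists, all other edges of the fundamental cut are met before `a` from the near
  -- side, so they point away from the far side.
  by_cases hex : ∃ e ∉ T, G.tail e ∉ G.farSide T a ∧ G.head e ∈ G.farSide T a ∧
      G.tourTime T d₀ a ≤ G.tourTime T d₀ e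
  · obtain ⟨e, he, h1, h2, hte⟩ := hex
    have hre : G.rev e ∉ T := fun h => he ((hT.revClosed.iff e).1 h)
    have hte' := ((hT.tourTime_farSide (d := G.rev e) ha h0).1 h2).1
    refine .inl ⟨_, hT.exchange hs ha he h1 h2, ?_, fun b hb => ?_⟩
    · rintro (⟨-, h⟩ | h | h)
      · exact h (.inl rfl)
      · exact he (h ▸ ha)
      · exact hre (Set.mem_singleton_iff.1 h ▸ ha)
    · have n1 : b ≠ a := by rintro rfl; omega
      have n2 : b ≠ G.rev a := by rintro rfl; omega
      have n3 : b ≠ e := by rintro rfl; omega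
      have n4 : b ≠ G.rev e := by rintro rfl; omega
      simp [n1, n2, n3, n4]
  · push Not at hex
    refine .inr fun b h1 h2 => ?_
    by_cases hb : b ∈ T
    · rwa [hT.eq_of_entering ha hb h1 h2]
    · have h3 := hex b hb h1 h2
      have h4 := ((hT.tourTime_farSide (d := G.rev b) ha h0).1 h2).1
      rw [hag b h3]
      refine (hT.isOrientation_tourOrientation d₀ b).1.resolve_right fun h => ?_
      rw [hT.tourOrientation_eq_one_iff_of_notMem hb] at h
      omega

variable (G) in
/-- `o` is an orientation with indegree function `x` that agrees with the orientation of `T` on the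
edges met before time `n`. -/
def Agrees (x : V → ℤ) (d₀ : D) (T : Set D) (n : ℕ) (o : D → ℤ) : Prop :=
  G.IsOrientation o ∧ G.headSum o = x ∧
    ∀ b, G.tourTime T d₀ b < n → o b = G.tourOrientation d₀ T b

variable (G) in
/-- Up to time `n`, the tree `T` has been chosen greedily: it agrees with some orientation with
indegree function `x`, and contains only edges without which this would be impossible. -/
def Greedy (x : V → ℤ) (d₀ : D) (n : ℕ) (T : Set D) : Prop :=
  (∃ o, G.Agrees x d₀ T n o) ∧ ∀ a ∈ T, G.tourTime T d₀ a < n →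
    G.tourTime T d₀ a < G.tourTime T d₀ (G.rev a) →
    ∀ o, G.Agrees x d₀ T (G.tourTime T d₀ a) o → o a = 1

variable {x : V → ℤ} {d₀ : D} {n : ℕ} {T T' : Set D}

omit [Fintype V] in
lemma Agrees.congr (hT : G.IsSpanningTree T) (hT' : G.IsSpanningTree T')
    (hag : ∀ b, G.tourTime T d₀ b < n → (b ∈ T ↔ b ∈ T')) {k : ℕ} (hk : k ≤ n) {o : D → ℤ} :
    G.Agrees x d₀ T' k o ↔ G.Agrees x d₀ T k o := by
  refine and_congr_right fun _ => and_congr_right fun _ => forall_congr' fun b => ?_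
  rw [IsSpanningTree.tourTime_lt_congr hT hT' hag (by omega)]
  refine imp_congr_right fun hb => ?_
  rw [IsSpanningTree.tourOrientation_congr hT hT' hag (.inl (by omega))]

omit [Fintype V] in
lemma Greedy.congr (hT : G.IsSpanningTree T) (hT' : G.IsSpanningTree T')
    (hag : ∀ b, G.tourTime T d₀ b < n → (b ∈ T ↔ b ∈ T')) (h : G.Greedy x d₀ n T) :
    G.Greedy x d₀ n T' := by
  obtain ⟨⟨o, ho⟩, h⟩ := h
  refine ⟨⟨o, (Agrees.congr hT hT' hag le_rfl).2 ho⟩, fun a ha han hlt o ho => ?_⟩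
  rw [IsSpanningTree.tourTime_lt_congr hT hT' hag (by omega)] at han
  have e : G.tourTime T' d₀ a = G.tourTime T d₀ a :=
    (IsSpanningTree.tourTime_congr hT hT' hag han.le a).2 rfl
  rw [e] at hlt ho
  rw [Agrees.congr hT hT' hag han.le] at ho
  refine h a ((hag a han).2 ha) han ?_ o ho
  have h1 := IsSpanningTree.tourTime_lt_congr hT hT' hag (k := G.tourTime T d₀ a + 1) (by omega)
    (G.rev a)
  omega

omit [Fintype V] in
/-- Extending a greedy choice by one step. -/
lemma Greedy.succ (hT : G.IsSpanningTree T) (h : G.Greedy x d₀ n T)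
    (hd : ∀ d, G.tourTime T d₀ d = n → n < G.tourTime T d₀ (G.rev d) →
      (d ∉ T ∧ ∃ o, G.Agrees x d₀ T n o ∧ o d = 0) ∨
      (d ∈ T ∧ ∀ o, G.Agrees x d₀ T n o → o d = 1)) : G.Greedy x d₀ (n + 1) T := by
  have hO := hT.isOrientation_tourOrientation d₀
  obtain ⟨⟨o, ho⟩, h⟩ := h
  constructor
  · by_cases hex : ∃ d, G.tourTime T d₀ d = n ∧ n < G.tourTime T d₀ (G.rev d)
    · obtain ⟨d, rfl, hlt⟩ := hex
      obtain ⟨o', ho', hd'⟩ : ∃ o', G.Agrees x d₀ T (G.tourTime T d₀ d) o' ∧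
          o' d = G.tourOrientation d₀ T d := by
        rcases hd d rfl hlt with ⟨hdT, o', ho', h0⟩ | ⟨hdT, h1⟩
        · refine ⟨o', ho', h0.trans ((hO d).1.resolve_right fun h => ?_).symm⟩
          rw [hT.tourOrientation_eq_one_iff_of_notMem hdT] at h
          omega
        · exact ⟨o, ho, (h1 o ho).trans ((tourOrientation_eq_one_iff_of_mem hdT).2 hlt).symm⟩
      refine ⟨o', ho'.1, ho'.2.1, fun b hb => ?_⟩
      rcases Nat.lt_succ_iff_lt_or_eq.1 hb with hb | hb
      · exact ho'.2.2 b hb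
      · rwa [hT.tourTime_inj.1 hb]
    · push Not at hex
      refine ⟨o, ho.1, ho.2.1, fun b hb => ?_⟩
      rcases Nat.lt_succ_iff_lt_or_eq.1 hb with hb | hb
      · exact ho.2.2 b hb
      -- The edge was met earlier in the other direction, where agreement is already known.
      · have h1 := hex b hb
        have h2 := hT.tourTime_ne_rev d₀ b
        have h3 := ho.2.2 (G.rev b) (by omega)
        rw [ho.1.rev_eq, hO.rev_eq] at h3
        linarith
  · intro a ha han hlt o ho
    rcases Nat.lt_succ_iff_lt_or_eq.1 han with han | han
    · exact h a ha han hlt o ho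
    · rw [han] at ho
      exact ((hd a han (by omega)).resolve_left fun h => h.1 ha).2 o ho

/-- At the newly met edge d the greedy rule dictates whether d belongs to the tree. If T disagrees,
d is exchanged for an edge met later, in the fundamental cut of d for T or for the dual tree. -/
lemma Greedy.exists_succ [Nonempty D] (hG : G.Connected) (hp : G.Planar)
    (hx : ∀ o, G.IsOrientation o → G.headSum o = x → G.ReachesAll o (G.tail d₀))
    (hT : G.IsSpanningTree T) (h : G.Greedy x d₀ n T) :
    ∃ T', G.IsSpanningTree T' ∧ G.Greedy x d₀ (n + 1) T' := by
  have hs := tail_surjective hG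
  by_cases hex : ∃ d, G.tourTime T d₀ d = n ∧ n < G.tourTime T d₀ (G.rev d)
  swap
  · exact ⟨T, hT, h.succ hT fun d h1 h2 => absurd ⟨d, h1, h2⟩ hex⟩
  obtain ⟨d, hdn, hlt⟩ := hex
  by_cases hdec : ∃ o, G.Agrees x d₀ T n o ∧ o d = 0
  · by_cases hdT : d ∈ T
    · obtain ⟨o, ho, hod⟩ := hdec
      rcases hT.exists_exchange_or_directed_cut hs (d₀ := d₀) hdT (by omega)
        (by rw [hdn]; exact ho.2.2) hod with ⟨T', hT', hd', hag⟩ | hcut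
      · rw [hdn] at hag
        refine ⟨T', hT', (h.congr hT hT' hag).succ hT' fun b hb _ => .inl ?_⟩
        rw [IsSpanningTree.tourTime_congr hT hT' hag le_rfl, ← hdn, hT.tourTime_inj] at hb
        subst hb
        exact ⟨hd', o, (Agrees.congr hT hT' hag le_rfl).2 ho, hod⟩
      · have h0 := (hT.tourTime_lt_rev_iff hdT).1 (hdn.trans_lt hlt)
        obtain ⟨b, hb, h1, h2⟩ := (hx o ho.1 ho.2.1 (G.head d)).exists_entering h0
          (head_mem_farSide T d)
        have hb : o b = 1 := hb
        have := hcut b h1 h2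
        omega
    · refine ⟨T, hT, h.succ hT fun b hb _ => .inl ?_⟩
      rw [← hdn, hT.tourTime_inj] at hb
      subst hb
      exact ⟨hdT, hdec⟩
  · have hone : ∀ o, G.Agrees x d₀ T n o → o d = 1 := fun o ho =>
      (ho.1 d).1.resolve_left fun h => hdec ⟨o, ho, h⟩
    by_cases hdT : d ∈ T
    · refine ⟨T, hT, h.succ hT fun b hb _ => .inr ?_⟩
      rw [← hdn, hT.tourTime_inj] at hb
      subst hb
      exact ⟨hdT, hone⟩
    obtain ⟨o, ho⟩ := h.1
    have hTd := hT.dual hG hp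
    have htd : ∀ b, G.dual.tourTime Tᶜ (G.rev d₀) b = G.tourTime T d₀ (G.rev b) :=
      dual_tourTime hT.revClosed d₀
    have hrd : G.rev d ∈ Tᶜ := hT.revClosed.compl d hdT
    have hO := hT.isOrientation_tourOrientation d₀
    -- Adding d to T amounts to removing it from the dual tree. The dart is `rev d` because the dual
    -- tour is reversed.
    rcases hTd.exists_exchange_or_directed_cut leftFace_surjective (d₀ := G.rev d₀) (o := o) hrd
      (by rw [htd, htd, dual_rev, rev_rev']; omega)
      (by
        intro b hb
        rw [htd, htd, rev_rev', hdn] at hb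
        have := ho.2.2 _ hb
        rw [ho.1.rev_eq, hO.rev_eq] at this
        rw [hT.dual_tourOrientation]
        linarith)
      (by rw [ho.1.rev_eq, hone o ho, sub_self]) with ⟨S, hS, hdS, hag⟩ | hcut
    · have hT' : G.IsSpanningTree Sᶜ := IsSpanningTree.of_dual hG hp (by rwa [compl_compl])
      have hag' : ∀ b, G.tourTime T d₀ b < n → (b ∈ T ↔ b ∈ Sᶜ) := by
        intro b hb
        have := hag (G.rev b) (by rwa [htd, htd, rev_rev', rev_rev', hdn])
        rw [Set.mem_compl_iff, hT.revClosed.iff] at this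
        rw [← hT'.revClosed.iff b, Set.mem_compl_iff, ← this, not_not]
      refine ⟨Sᶜ, hT', (h.congr hT hT' hag').succ hT' fun b hb _ => .inr ?_⟩
      rw [IsSpanningTree.tourTime_congr hT hT' hag' le_rfl, ← hdn, hT.tourTime_inj] at hb
      subst hb
      refine ⟨(hT'.revClosed.iff b).1 hdS, fun o' ho' => ?_⟩
      exact hone o' ((Agrees.congr hT hT' hag' le_rfl).1 ho')
    · exfalso
      classical
      set X := G.dual.farSide Tᶜ (G.rev d) with hX
      have ho' : G.IsOrientation (o + (G.dual.coboundary (X.indicator 1)).1) :=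
        IsOrientation.add_cut (G := G.dual) ho.1 hcut
      -- A dual cut is a flow of G, so reversing the directed dual cut preserves the indegrees,
      -- while d becomes negative.
      set o' := o + (G.dual.coboundary (X.indicator 1)).1 with ho'_def
      have hval : ∀ b, o' b = o b + ((if G.dual.head b ∈ X then 1 else 0) -
          (if G.dual.tail b ∈ X then 1 else 0)) := by
        intro b
        rw [← coboundary_indicator]
        rfl
      have hx' : G.headSum o' = x := by
        have := boundary_dual_coboundary (G := G) (X.indicator 1)
        rw [boundary_eq_headSum] at this
        rw [ho'_def, headSum_add, ho.2.1]
        exact (congrArg (x + ·) this).trans (add_zero x)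
      have hd1 : G.dual.head d ∉ X := by
        have := hTd.tail_notMem_farSide hrd
        rwa [← G.dual_rev, tail_rev] at this
      have hd2 : G.dual.tail d ∈ X := by
        have := head_mem_farSide (G := G.dual) Tᶜ (G.rev d)
        rwa [← G.dual_rev, head_rev] at this
      have hod' : o' d = 0 := by
        rw [hval, if_neg hd1, if_pos hd2, hone o ho]
        norm_num
      by_cases hagr : ∀ b, G.tourTime T d₀ b < n → o' b = G.tourOrientation d₀ T b
      · exact hdec ⟨o', ⟨ho', hx', hagr⟩, hod'⟩
      push Not at hagr
      obtain ⟨b, ⟨hbn, hbo⟩, hmin⟩ := WellFounded.has_min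
        (InvImage.wf (G.tourTime T d₀) Nat.lt_wfRel.wf)
        {b | G.tourTime T d₀ b < n ∧ o' b ≠ G.tourOrientation d₀ T b} hagr
      have hmin' : ∀ c, G.tourTime T d₀ c < G.tourTime T d₀ b →
          o' c = G.tourOrientation d₀ T c := by
        intro c hc
        by_contra hne
        exact hmin c ⟨by omega, hne⟩ hc
      -- Among the edges outside T only that of d crosses this dual cut, so the first deviation of
      -- `o'` occurs at a tree edge. There greediness forces the value 1, so there is no deviation.
      have hbT : b ∈ T := by
        by_contra hbT
        have hb1 : b ≠ G.rev d := by rintro rfl; omega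
        have hb2 : b ≠ G.dual.rev (G.rev d) := by
          rw [dual_rev, rev_rev']
          rintro rfl; omega
        have := hTd.farSide_iff (a := G.rev d) hbT hb1 hb2
        refine hbo ?_
        rw [hval, ← ho.2.2 b hbn]
        by_cases h : G.dual.tail b ∈ X
        · rw [if_pos h, if_pos (this.1 h)]; ring
        · rw [if_neg h, if_neg (fun h' => h (this.2 h'))]; ring
      have hblt : G.tourTime T d₀ b < G.tourTime T d₀ (G.rev b) := by
        by_contra! hge
        have := hmin' (G.rev b) (lt_of_le_of_ne hge (hT.tourTime_ne_rev d₀ b).symm)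
        rw [ho'.rev_eq, hO.rev_eq] at this
        exact hbo (by linarith)
      have h1 := h.2 b hbT hbn hblt o' ⟨ho', hx', hmin'⟩
      exact hbo (h1.trans ((tourOrientation_eq_one_iff_of_mem hbT).2 hblt).symm)

/-- An orientation for which everything can be reached from the root has the same indegrees as the
orientation of some spanning tree. -/
theorem exists_isSpanningTree_headSum_eq [Nonempty D] (hG : G.Connected) (hp : G.Planar) {o : D → ℤ}
    (ho : G.IsOrientation o) (hr : G.ReachesAll o (G.tail d₀)) :
    ∃ T, G.IsSpanningTree T ∧ G.headSum (G.tourOrientation d₀ T) = G.headSum o := by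
  have key : ∀ n, ∃ T, G.IsSpanningTree T ∧ G.Greedy (G.headSum o) d₀ n T := by
    intro n
    induction n with
    | zero =>
      obtain ⟨T, hT⟩ := hG.exists_isSpanningTree
      exact ⟨T, hT, ⟨o, ho, rfl, fun b hb => absurd hb (by omega)⟩,
        fun a _ ha => absurd ha (by omega)⟩
    | succ n ih =>
      obtain ⟨T, hT, h⟩ := ih
      exact h.exists_succ hG hp (fun o' ho' he => hr.of_headSum_eq ho ho' he) hT
  obtain ⟨T, hT, ⟨o', ho', he, hag⟩, -⟩ := key (Fintype.card D)
  refine ⟨T, hT, ?_⟩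
  rw [← he]
  congr 1
  funext b
  exact (hag b (hT.tourTime_lt_card _ _)).symm

end Surjective

/-! ### Bijectivity of the Bernardi map -/

section Bijective

variable {V D : Type*} [Fintype V] [Fintype D] {G : RibbonGraph V D}

theorem bernardiClass_bijOn [Nonempty D] (hG : G.Connected) (hp : G.Planar) (d₀ : D) :
    Set.BijOn (G.bernardiClass d₀) Set.univ (G.picDeg G.genus) := by
  classical
  have hs := tail_surjective hG
  have h2 := two_dvd_card hG
  refine ⟨?_, (bernardiClass_injective hs d₀).injOn, ?_⟩
  · rintro ⟨T, hT⟩ -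
    refine ⟨_, ?_, rfl⟩
    have h1 := congrArg (fun x => ∑ v, x v) (hT.bernardiDivisor_add hs d₀)
    simp only [Pi.add_apply, Finset.sum_add_distrib, sum_headSum, sum_ne_root] at h1
    have h3 := (hT.isOrientation_tourOrientation d₀).two_mul_sum
    show ∑ v, G.bernardiDivisor d₀ T v = G.genus
    unfold genus
    omega
  · rintro _ ⟨x, hx, rfl⟩
    have hx : ∑ v, x v = G.genus := hx
    obtain ⟨o, ho, hr, hox⟩ := exists_reachesAll_divClass_eq hG (G.tail d₀)
      (x := x + fun v => if v = G.tail d₀ then 0 else 1) (by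
        simp only [Pi.add_apply, Finset.sum_add_distrib, sum_ne_root, hx]
        unfold genus
        omega)
    obtain ⟨T, hT, hTo⟩ := exists_isSpanningTree_headSum_eq hG hp ho hr
    refine ⟨⟨T, hT⟩, trivial, ?_⟩
    rw [← hTo, ← hT.bernardiDivisor_add hs d₀, map_add, map_add, add_left_inj] at hox
    exact hox

end Bijective

/-! ### Moving the start of the tour -/

section BaseChange

variable {V D : Type*} [Finite D] {G : RibbonGraph V D} {T : Set D}

omit [Finite D] in
lemma tourTime_lt_of_iterate_eq {d₀ : D} {k : ℕ} (hk : 0 < k) (h : (G.tourStep T)^[k] d₀ = d₀)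
    (htr : G.TourTransitive T) (b : D) : G.tourTime T d₀ b < k := by
  obtain ⟨n, hn⟩ := htr d₀ b
  have h' : Function.IsPeriodicPt (G.tourStep T) k d₀ := h
  rw [← h'.iterate_mod_apply] at hn
  exact (tourTime_le hn).trans_lt (Nat.mod_lt _ hk)

/-- Moving the start of the tour past a sequence of `k` darts. -/
lemma IsSpanningTree.tourTime_iterate_add (hT : G.IsSpanningTree T) {d₀ b : D} {k : ℕ}
    (hk : k ≤ G.tourTime T d₀ b) :
    G.tourTime T ((G.tourStep T)^[k] d₀) b + k = G.tourTime T d₀ b := by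
  apply le_antisymm
  · have : (G.tourStep T)^[G.tourTime T d₀ b - k] ((G.tourStep T)^[k] d₀) = b := by
      rw [← Function.iterate_add_apply, Nat.sub_add_cancel hk, hT.iterate_tourTime]
    have := tourTime_le this
    omega
  · refine tourTime_le ?_
    rw [Function.iterate_add_apply, hT.iterate_tourTime]

lemma IsSpanningTree.tourOrientation_congr_of_mem (hT : G.IsSpanningTree T) {d₀ d₁ a : D}
    (h : G.tail d₀ = G.tail d₁) (ha : a ∈ T) :
    G.tourOrientation d₀ T a = G.tourOrientation d₁ T a := by
  classical
  simp only [tourOrientation, ha, true_iff, hT.tourTime_lt_rev_iff ha, h]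

/-- Moving the start of the tour to the next dart at the same vertex changes the orientation of a
spanning tree, up to cuts, by an edge that does not depend on the tree. -/
lemma IsSpanningTree.tourOrientation_next (hT : G.IsSpanningTree T) (d₀ : D) :
    ∃ f : V → ℤ, ∀ b, G.tourOrientation (G.next d₀) T b - G.tourOrientation d₀ T b =
      (G.edgeChain d₀).1 b + (G.coboundary f).1 b := by
  classical
  set d₁ := G.next d₀ with hd₁
  have hO := hT.isOrientation_tourOrientation d₀
  have hO₁ := hT.isOrientation_tourOrientation d₁
  have htail : G.tail d₀ = G.tail d₁ := (G.tail_next d₀).symm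
  by_cases hd : d₀ ∈ T
  -- From `d₀` the tour covers the far side X first and the rest afterwards; from `next d₀` these
  -- two stretches are swapped. Exactly the non-tree edges crossing the cut are reversed, so the
  -- change is minus the cut, corrected by the chain of `d₀` at the tree edge itself.
  · set X := G.farSide T d₀ with hX
    refine ⟨-X.indicator 1, ?_⟩
    have htX : G.tail d₀ ∉ X := hT.tail_notMem_farSide hd
    have hhX : G.head d₀ ∈ X := head_mem_farSide T d₀
    have hstep : G.tourStep T (G.rev d₀) = d₁ := by
      rw [tourStep_of_mem (hT.rev_mem _ hd), rev_rev']
    have far₀ := fun b => hT.tourTime_farSide (d₀ := d₀) (d := b) hd htX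
    have far₁ := fun b => hT.tourTime_farSide (d₀ := d₁) (d := b) hd (htail ▸ htX)
    simp only [tourTime_self] at far₀
    have hlast : ∀ b, G.tourTime T d₁ b < G.tourTime T d₁ (G.rev d₀) + 1 := by
      refine tourTime_lt_of_iterate_eq (Nat.succ_pos _) ?_ hT.tourTransitive
      rw [Function.iterate_succ_apply', hT.iterate_tourTime, hstep]
    have hpos : ∀ b ∉ T, 0 < G.tourTime T d₀ b := by
      intro b hb
      refine Nat.pos_of_ne_zero fun h => hb ?_
      rw [← tourTime_self (G := G) (T := T) (d₀ := d₀), hT.tourTime_inj] at h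
      rwa [h]
    have hout : ∀ b ∉ T, G.tail b ∉ X →
        G.tourTime T d₁ b + (G.tourTime T d₀ (G.rev d₀) + 1) = G.tourTime T d₀ b := by
      intro b hb hbX
      have h1 := hpos b hb
      have h2 := (far₀ b).not.1 hbX
      have h3 := hT.tourTime_iterate_add (d₀ := d₀) (b := b)
        (k := G.tourTime T d₀ (G.rev d₀) + 1) (by omega)
      rwa [Function.iterate_succ_apply', hT.iterate_tourTime, hstep] at h3
    have hin : ∀ b, G.tail b ∈ X →
        G.tourTime T d₀ b + G.tourTime T d₁ d₀ = G.tourTime T d₁ b := by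
      intro b hbX
      have h3 := hT.tourTime_iterate_add (d₀ := d₁) (b := b) (k := G.tourTime T d₁ d₀)
        ((far₁ b).1 hbX).1.le
      rwa [hT.iterate_tourTime] at h3
    have hent : ∀ b ∉ T, G.tail b ∉ X → G.head b ∈ X →
        G.tourOrientation d₁ T b - G.tourOrientation d₀ T b = -1 := by
      intro b hb h1 h2
      have e1 : G.tourOrientation d₀ T b = 1 := by
        rw [hT.tourOrientation_eq_one_iff_of_notMem hb]
        have := (far₀ (G.rev b)).1 h2
        have := (far₀ b).not.1 h1
        have := hpos b hb
        omega
      have e2 : G.tourOrientation d₁ T b = 0 := by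
        refine (hO₁ b).1.resolve_right fun h => ?_
        rw [hT.tourOrientation_eq_one_iff_of_notMem hb] at h
        have := (far₁ (G.rev b)).1 h2
        have := (far₁ b).not.1 h1
        have := hlast b
        omega
      rw [e1, e2]
      norm_num
    have hsame : ∀ b ∉ T, (G.tail b ∈ X ↔ G.head b ∈ X) →
        G.tourOrientation d₁ T b - G.tourOrientation d₀ T b = 0 := by
      intro b hb h
      have hrb : G.rev b ∉ T := fun h => hb ((hT.revClosed.iff b).1 h)
      have hlt : (G.tourTime T d₁ b < G.tourTime T d₁ (G.rev b)) ↔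
          (G.tourTime T d₀ b < G.tourTime T d₀ (G.rev b)) := by
        by_cases h1 : G.tail b ∈ X
        · have := hin b h1
          have := hin (G.rev b) (h.1 h1)
          omega
        · have := hout b hb h1
          have := hout (G.rev b) hrb (fun h' => h1 (h.2 h'))
          omega
      simp only [tourOrientation, hb, false_iff, hlt, sub_self]
    intro b
    have hne := G.rev_ne d₀
    rw [map_neg]
    show _ = _ + -(G.coboundary (X.indicator 1)).1 b
    rw [coboundary_indicator, edgeChain_apply]
    by_cases hb : b ∈ T
    · rw [hT.tourOrientation_congr_of_mem htail hb, sub_self]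
      by_cases h1 : b = d₀
      · subst h1
        simp [htX, hhX, hne.symm]
      by_cases h2 : b = G.rev d₀
      · subst h2
        simp [htX, hhX, hne]
      · have := hT.farSide_iff hb h1 h2
        simp [h1, h2, hX, this]
    · have h1 : b ≠ d₀ := fun h => hb (h ▸ hd)
      have h2 : b ≠ G.rev d₀ := fun h => hb (h ▸ hT.rev_mem _ hd)
      rw [if_neg h1, if_neg h2]
      by_cases ht : G.tail b ∈ X <;> by_cases hh : G.head b ∈ X
      · rw [hsame b hb (iff_of_true ht hh)]; simp [ht, hh]
      · have := hent (G.rev b) (fun h => hb ((hT.revClosed.iff b).1 h)) hh (by rwa [head_rev])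
        rw [hO₁.rev_eq, hO.rev_eq] at this
        simp [ht, hh]
        linarith
      · rw [hent b hb ht hh]; simp [ht, hh]
      · rw [hsame b hb (iff_of_false ht hh)]; simp [ht, hh]
  -- Here `d₀` just moves from the first to the last place of the tour, so only its own edge is
  -- reversed.
  · refine ⟨0, fun b => ?_⟩
    rw [map_zero, edgeChain_apply]
    show _ = _ + (0 : ℤ)
    rw [add_zero]
    have hstep : G.tourStep T d₀ = d₁ := tourStep_of_notMem hd
    have hlast : ∀ b, G.tourTime T d₁ b < G.tourTime T d₁ d₀ + 1 := by
      refine tourTime_lt_of_iterate_eq (Nat.succ_pos _) ?_ hT.tourTransitive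
      rw [Function.iterate_succ_apply', hT.iterate_tourTime, hstep]
    have hshift : ∀ b, b ≠ d₀ → G.tourTime T d₁ b + 1 = G.tourTime T d₀ b := by
      intro b hb
      have : 0 < G.tourTime T d₀ b := by
        refine Nat.pos_of_ne_zero fun h => hb ?_
        rwa [← tourTime_self (G := G) (T := T) (d₀ := d₀), hT.tourTime_inj] at h
      have h3 := hT.tourTime_iterate_add (d₀ := d₀) (b := b) (k := 1) this
      rwa [Function.iterate_one, hstep] at h3
    have hflip : G.tourOrientation d₁ T d₀ - G.tourOrientation d₀ T d₀ = 1 := by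
      have h1 := hT.tourTime_ne_rev d₁ d₀
      have h2 := hlast (G.rev d₀)
      have e1 : G.tourOrientation d₁ T d₀ = 1 := by
        rw [hT.tourOrientation_eq_one_iff_of_notMem hd]
        omega
      have e2 : G.tourOrientation d₀ T d₀ = 0 := by
        refine (hO d₀).1.resolve_right fun h => ?_
        rw [hT.tourOrientation_eq_one_iff_of_notMem hd, tourTime_self] at h
        omega
      rw [e1, e2]
      norm_num
    have hne := G.rev_ne d₀
    by_cases h1 : b = d₀
    · subst h1
      rw [hflip]; simp [hne.symm]
    by_cases h2 : b = G.rev d₀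
    · subst h2
      rw [hO₁.rev_eq, hO.rev_eq]
      simp [hne]
      linarith
    · have e1 := hshift b h1
      have e2 := hshift (G.rev b) (by rwa [ne_eq, G.rev_eq_iff])
      have hlt : (G.tourTime T d₁ b < G.tourTime T d₁ (G.rev b)) ↔
          (G.tourTime T d₀ b < G.tourTime T d₀ (G.rev b)) := by omega
      simp [tourOrientation, hlt, h1, h2]

end BaseChange

/-! ### Independence of the start and compatibility with duality -/

section Duality

variable {V D : Type*} [Fintype V] [Fintype D] {G : RibbonGraph V D}

/-- The difference of the orientations of two spanning trees, for tours with the same start. -/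
noncomputable def SpanningTree.diff (T T' : G.SpanningTree) (d : D) : G.chains :=
  (T.2.isOrientation_tourOrientation d).diff (T'.2.isOrientation_tourOrientation d)

omit [Fintype V] in
lemma divClass_boundary_diff (hs : Function.Surjective G.tail) (T T' : G.SpanningTree) (d : D) :
    G.divClass (G.boundary (T.diff T' d)) = G.bernardiClass d T - G.bernardiClass d T' := by
  rw [SpanningTree.diff, IsOrientation.boundary_diff, ← T.2.bernardiDivisor_add hs,
    ← T'.2.bernardiDivisor_add hs, add_sub_add_right_eq_sub, map_sub]
  rfl

omit [Fintype V] in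
lemma mk_diff_next (T T' : G.SpanningTree) (d : D) :
    (QuotientAddGroup.mk (T.diff T' (G.next d)) : G.ChainQuot) =
      QuotientAddGroup.mk (T.diff T' d) := by
  obtain ⟨f, hf⟩ := T.2.tourOrientation_next d
  obtain ⟨f', hf'⟩ := T'.2.tourOrientation_next d
  rw [eq_comm, QuotientAddGroup.eq]
  refine AddSubgroup.mem_sup_right ⟨f - f', ?_⟩
  ext b
  show (G.coboundary (f - f')).1 b = -(G.tourOrientation d T.1 b - G.tourOrientation d T'.1 b) +
    (G.tourOrientation (G.next d) T.1 b - G.tourOrientation (G.next d) T'.1 b)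
  have h1 := hf b
  have h2 := hf' b
  rw [map_sub]
  show (G.coboundary f).1 b - (G.coboundary f').1 b = _
  linarith

variable [Nonempty D] (hG : G.Connected) (hp : G.Planar)

variable (G) in
/-- Complementation as a bijection between the spanning trees of `G` and of its dual. -/
def dualTreeEquiv : G.SpanningTree ≃ G.dual.SpanningTree where
  toFun T := ⟨T.1ᶜ, T.2.dual hG hp⟩
  invFun T := ⟨T.1ᶜ, IsSpanningTree.of_dual hG hp (by rw [compl_compl]; exact T.2)⟩
  left_inv T := Subtype.ext (compl_compl _)
  right_inv T := Subtype.ext (compl_compl _)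

lemma dualChain_diff (T T' : G.SpanningTree) (d : D) :
    G.dualChain (T.diff T' d) =
      (G.dualTreeEquiv hG hp T).diff (G.dualTreeEquiv hG hp T') (G.rev d) := by
  ext b
  show G.tourOrientation d T.1 b - G.tourOrientation d T'.1 b =
    G.dual.tourOrientation (G.rev d) T.1ᶜ b - G.dual.tourOrientation (G.rev d) T'.1ᶜ b
  rw [T.2.dual_tourOrientation, T'.2.dual_tourOrientation]

include hG hp in
/-- In the planar case, the class of the difference of the orientations of two spanning trees
does not depend on the start of the tours. -/
lemma mk_diff_eq (T T' : G.SpanningTree) (d d' : D) :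
    (QuotientAddGroup.mk (T.diff T' d) : G.ChainQuot) = QuotientAddGroup.mk (T.diff T' d') := by
  -- Starts `rev d` and `next (rev d)` are equivalent in G. In the dual they become d and `next (rev
  -- d)` up to `rev`, and the dual rotation sends `rev d` to `rev (next (rev d))`.
  have hrev : ∀ d, (QuotientAddGroup.mk (T.diff T' (G.rev d)) : G.ChainQuot) =
      QuotientAddGroup.mk (T.diff T' d) := by
    intro d
    rw [← mk_diff_next]
    apply (G.dualChainQuotEquiv hG hp).injective
    rw [dualChainQuotEquiv_mk, dualChainQuotEquiv_mk, dualChain_diff hG hp, dualChain_diff hG hp,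
      ← mk_diff_next _ _ (G.rev d), dual_next]
  have htail : ∀ d d', G.tail d = G.tail d' →
      (QuotientAddGroup.mk (T.diff T' d) : G.ChainQuot) = QuotientAddGroup.mk (T.diff T' d') := by
    intro d d' h
    obtain ⟨k, rfl⟩ := ((G.sameCycle_iff d d').2 h).exists_nat_pow_eq
    clear h
    induction k with
    | zero => rfl
    | succ k ih => rw [pow_succ', Equiv.Perm.mul_apply, mk_diff_next, ih]
  have key : ∀ {u v}, G.Reachable Set.univ u v → ∀ d d', G.tail d = u → G.tail d' = v →
      (QuotientAddGroup.mk (T.diff T' d) : G.ChainQuot) = QuotientAddGroup.mk (T.diff T' d') := by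
    intro u v h
    induction h with
    | refl => exact fun d d' h h' => htail d d' (h.trans h'.symm)
    | tail _ hb ih =>
      obtain ⟨b, -, rfl, rfl⟩ := hb
      intro d d' h h'
      rw [ih d b h rfl, ← hrev b]
      exact htail _ _ h'.symm
  exact key (hG.2 _ _) d d' rfl rfl

omit [Nonempty D] in
/-- The defining property of the Bernardi action. -/
lemma bernardiClass_bernardiAction {d₀ : D}
    (hb : Set.BijOn (G.bernardiClass d₀) Set.univ (G.picDeg G.genus)) (γ : G.pic0)
    (T : G.SpanningTree) : G.bernardiClass d₀ (G.bernardiAction d₀ γ T) =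
      (γ : G.Pic) + G.bernardiClass d₀ T := by
  obtain ⟨x, hx, hxγ⟩ := γ.2
  obtain ⟨y, hy, hyT⟩ := hb.mapsTo (Set.mem_univ T)
  obtain ⟨T', -, hT'⟩ := hb.surjOn (a := (γ : G.Pic) + G.bernardiClass d₀ T) (by
    refine ⟨x + y, ?_, by rw [map_add, hxγ, hyT]⟩
    have hx : ∑ v, x v = 0 := hx
    have hy : ∑ v, y v = G.genus := hy
    show ∑ v, (x v + y v) = G.genus
    rw [Finset.sum_add_distrib, hx, hy, zero_add])
  have : Nonempty G.SpanningTree := ⟨T⟩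
  exact Function.invFun_eq ⟨T', hT'⟩

end Duality

end RibbonGraph

open RibbonGraph in
theorem theorem6p1 {V D : Type*} [Fintype V] [Fintype D] [Nonempty D] (G : RibbonGraph V D)
    (hconn : G.Connected) (hloop : G.Loopless) (hbridge : G.Bridgeless) (hplanar : G.Planar) :
    (∀ d₀ : D, Set.BijOn (G.bernardiClass d₀) Set.univ (G.picDeg G.genus)) ∧
    (∀ e₀ : D, Set.BijOn (G.dual.bernardiClass e₀) Set.univ (G.dual.picDeg G.dual.genus)) ∧
    ∃ (σ : G.SpanningTree ≃ G.dual.SpanningTree) (Ψ : G.pic0 ≃+ G.dual.pic0),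
      (∀ T : G.SpanningTree, (σ T).1 = (T.1)ᶜ) ∧
      G.IsDualityIso Ψ ∧
      ∀ (d₀ e₀ : D) (γ : G.pic0) (T : G.SpanningTree),
        G.dual.bernardiAction e₀ (Ψ γ) (σ T) = σ (G.bernardiAction d₀ γ T) := by
  have hs := tail_surjective hconn
  have hconn' := hconn.dual hplanar
  have hb := bernardiClass_bijOn hconn hplanar
  have hb' := bernardiClass_bijOn hconn' (hplanar.dual hs)
  refine ⟨hb, hb', G.dualTreeEquiv hconn hplanar,
    ((G.chainQuotEquiv hconn).symm.trans (G.dualChainQuotEquiv hconn hplanar)).trans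
      (G.dual.chainQuotEquiv hconn'), fun T => rfl,
    ⟨G.chainQuotEquiv hconn, G.dualChainQuotEquiv hconn hplanar, G.dual.chainQuotEquiv hconn',
      chainQuotEquiv_mk hconn, dualChainQuotEquiv_mk hconn hplanar, chainQuotEquiv_mk hconn', rfl⟩,
    fun d₀ e₀ γ T => ?_⟩
  apply bernardiClass_injective leftFace_surjective e₀
  rw [bernardiClass_bernardiAction (hb' e₀)]
  set T' := G.bernardiAction d₀ γ T with hT'
  -- With γ represented by a difference chain, the start is changed from `d₀` to `rev e₀`, whose
  -- dual start is `e₀`.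
  have hγ : γ = G.chainQuotEquiv hconn (QuotientAddGroup.mk (T'.diff T d₀)) := by
    apply Subtype.ext
    rw [chainQuotEquiv_mk, divClass_boundary_diff hs, hT', bernardiClass_bernardiAction (hb d₀),
      add_sub_cancel_right]
  rw [hγ, AddEquiv.trans_apply, AddEquiv.trans_apply, AddEquiv.symm_apply_apply,
    mk_diff_eq hconn hplanar _ _ d₀ (G.rev e₀), dualChainQuotEquiv_mk,
    dualChain_diff hconn hplanar, rev_rev', chainQuotEquiv_mk,
    divClass_boundary_diff leftFace_surjective, sub_add_cancel]
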